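/- Let $\mathcal X$ be a Polish space and let $K\ge 1$ and $1=\alpha_1\ge\alpha_2\ge\cdots\ge\alpha_K\ge 0$. Let $\{\mu^{t}\}_{t\in(0,\infty)}$ be Borel probability measures on $\mathcal X$, $\mu^{t}$ having a density $g^{t}:\mathcal X\to[0,\infty)$ with respect to a common $\sigma$-finite reference measure $\gamma$; if some $\alpha_j=0$, let also a probability measure $\mu^{\infty}$ with density $g^{\infty}$ be given, and read $\varepsilon/0=\infty$. Let $I:\mathcal X\to[0,\infty]$ be a rate function ($\{I\le M\}$ is compact for every $M\in[0,\infty)$) that is continuous on its domain of finiteness $\{I<\infty\}$, and suppose that $\{\mu^{\varepsilon}\}$ satisfies the large deviation principle with rate function $I$ as $\varepsilon\downarrow 0$: $\limsup_{\varepsilon\to0}\varepsilon\log\mu^\varepsilon(C)\le-\inf_C I$ for closed $C$ and $\liminf_{\varepsilon\to0}\varepsilon\log\mu^\varepsilon(U)\ge-\inf_U I$ for open $U$. For $\mathbf x\in\mathcal X^K$ and a permutation $\sigma\in\Sigma_K$ write $\mathbf x_\sigma=(x_{\sigma(1)},\dots,x_{\sigma(K)})$ and put $$\rho^{\varepsilon}(\mathbf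 x;\boldsymbol\alpha)=\frac{e^{-\frac1\varepsilon\sum_{j}\alpha_jI(x_j)}}{\sum_{\tau\in\Sigma_K}e^{-\frac1\varepsilon\sum_{j}\alpha_jI(x_{\tau(j)})}},\qquad \tilde\rho^{\varepsilon}(\mathbf x;\boldsymbol\alpha)=\frac{\prod_{j}g^{\varepsilon/\alpha_j}(x_j)}{\sum_{\tau\in\Sigma_K}\prod_{j}g^{\varepsilon/\alpha_j}(x_{\tau(j)})}$$ (with $e^{-\infty}=0$, $0\cdot\infty=0$, and a weight being $0$ where its denominator vanishes). Let $\mathbf X^\varepsilon=(X_1^\varepsilon,\dots,X_K^\varepsilon)$ have independent components with $X_j^\varepsilon\sim\mu^{\varepsilon/\alpha_j}$, let $F^\varepsilon:\mathcal X\to\mathbb R$ be measurable, and let $$\tilde\eta^\varepsilon(\mathbf X^\varepsilon;\boldsymbol\alpha)=\sum_{\sigma\in\Sigma_K}\tilde\rho^\varepsilon(\mathbf X^\varepsilon_\sigma;\boldsymbol\alpha)\,e^{-\frac1\varepsilon F^\varepsilon(X^\varepsilon_{\sigma(1)})}.$$ Let $F:\mathcal X\to\mathbb R$ be continuous and bounded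 below. Suppose that, as $\varepsilon\downarrow0$, $\varepsilon\log(\tilde\rho^\varepsilon/\rho^\varepsilon)\to0$ uniformly on each compact subset of $\mathcal X^K$ (on each compact set, for all small $\varepsilon$, the two weights vanish at the same points, where nothing more is required), that $F^\varepsilon\to F$ uniformly on each compact subset of $\mathcal X$, and that $\inf_{\varepsilon\in(0,1)}\inf_{x\in\mathcal X}F^\varepsilon(x)>-\infty$. Then $$\lim_{\varepsilon\to0}-\varepsilon\log E\big[\tilde\eta^\varepsilon(\mathbf X^\varepsilon;\boldsymbol\alpha)^2\big]=V_F(\boldsymbol\alpha),$$ where $$V_F(\boldsymbol\alpha)=\inf\Big\{2\sum_{j=1}^K\alpha_jI_j+2F(x)-\min_{\sigma\in\Sigma_K}\sum_{j=1}^K\alpha_jI_{\sigma(j)}\;:\;x\in\mathcal X,\ I_1=I(x)<\infty,\ I_j\in[0,I_1]\text{ for }j\ge2\Big\}.$$ -/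

import Mathlib

open Filter MeasureTheory Topology
open scoped ENNReal NNReal

noncomputable section

namespace INS

/-- `I` is a rate function: all its sublevel sets at finite heights are compact. -/
def IsRateFunction {S : Type*} [TopologicalSpace S] (I : S → ℝ≥0∞) : Prop :=
  ∀ M : ℝ≥0, IsCompact {x | I x ≤ M}

/-- The family `ν ε`, `ε ↓ 0`, satisfies the large deviation principle with rate function `I`
and scaling `ε`. The logarithm is extended-real valued (`log 0 = -∞`). -/
structure SatisfiesLDP {S : Type*} [TopologicalSpace S] [MeasurableSpace S]
    (ν : ℝ → Measure S) (I : S → ℝ≥0∞) : Prop where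
  rate : IsRateFunction I
  upper : ∀ C : Set S, IsClosed C →
    limsup (fun ε : ℝ => (ε : EReal) * ENNReal.log (ν ε C)) (𝓝[>] 0)
      ≤ -(⨅ x ∈ C, (I x : EReal))
  lower : ∀ U : Set S, IsOpen U →
    -(⨅ x ∈ U, (I x : EReal))
      ≤ liminf (fun ε : ℝ => (ε : EReal) * ENNReal.log (ν ε U)) (𝓝[>] 0)

/-- The temperature `ε / α`, an element of `(0, ∞]` when `ε > 0`; it is `∞` exactly for `α ≤ 0`. -/
def temp (ε α : ℝ) : ℝ≥0∞ := ENNReal.ofReal ε / ENNReal.ofReal α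

/-- `e ^ (-s)` for `s ∈ [0, ∞]`, with `e ^ (-∞) = 0`. -/
def expNeg (s : ℝ≥0∞) : ℝ := if s = ∞ then 0 else Real.exp (-s.toReal)

section Weights

variable {S : Type*} {K : ℕ}

/-- `w (x) / ∑ τ, w (x_τ)`, where `x_τ = (x_{τ(1)}, …, x_{τ(K)})`;
it is `0` where the denominator vanishes. -/
def symWeight (w : (Fin K → S) → ℝ) (x : Fin K → S) : ℝ :=
  w x / ∑ τ : Equiv.Perm (Fin K), w (fun j => x (τ j))

/-- The weight `ρ^ε (x; α)` built from the rate function `I`. -/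
def rho (I : S → ℝ≥0∞) (α : Fin K → ℝ) (ε : ℝ) : (Fin K → S) → ℝ :=
  symWeight fun x => expNeg (∑ j, ENNReal.ofReal (α j / ε) * I (x j))

/-- The weight `ρ̃^ε (x; α)` built from the densities `g^{ε/α_j}`. -/
def rhoTilde (g : ℝ≥0∞ → S → ℝ≥0) (α : Fin K → ℝ) (ε : ℝ) : (Fin K → S) → ℝ :=
  symWeight fun x => ∏ j, (g (temp ε (α j)) (x j) : ℝ)

/-- A single sample of the generalized INS estimator, as a function of the sample point `x`:
`η̃^ε (x; α) = ∑ σ, ρ̃^ε (x_σ; α) e ^ (-F^ε (x_{σ(1)}) / ε)`. -/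
def etaTilde [NeZero K] (g : ℝ≥0∞ → S → ℝ≥0) (Fε : ℝ → S → ℝ) (α : Fin K → ℝ) (ε : ℝ)
    (x : Fin K → S) : ℝ :=
  ∑ σ : Equiv.Perm (Fin K),
    rhoTilde g α ε (fun j => x (σ j)) * Real.exp (-(1 / ε) * Fε ε (x (σ 0)))

/-- `ε log (ρ̃^ε / ρ^ε) → 0` as `ε ↓ 0`, uniformly on each compact subset of the product space.
The logarithm has to be finite: either both weights are positive, or both vanish, in which case
the quotient imposes no further condition (`Real.log 0 = 0`). -/
def LogRatioTendstoZero [TopologicalSpace S] (I : S → ℝ≥0∞) (g : ℝ≥0∞ → S → ℝ≥0)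
    (α : Fin K → ℝ) : Prop :=
  ∀ C : Set (Fin K → S), IsCompact C → ∀ δ : ℝ, 0 < δ → ∀ᶠ ε in 𝓝[>] (0 : ℝ), ∀ x ∈ C,
    (rhoTilde g α ε x = 0 ↔ rho I α ε x = 0) ∧
      |ε * Real.log (rhoTilde g α ε x / rho I α ε x)| < δ

/-- `V_F (α)`: the infimum of
`2 ∑ j, α_j I_j + 2 F - min_σ ∑ j, α_j I_{σ(j)}` over `(I_1, F) ∈ {(I x, F x)}` with `I_1 < ∞`
and over `I_j ∈ [0, I_1]`, `j ≥ 2`. -/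
def V [NeZero K] (I : S → ℝ≥0∞) (F : S → ℝ) (α : Fin K → ℝ) : EReal :=
  ⨅ (v : Fin K → ℝ≥0) (f : ℝ)
    (_ : ((v 0 : ℝ≥0∞), f) ∈ Set.range fun x => (I x, F x)) (_ : ∀ j, v j ≤ v 0),
    ((2 * ∑ j, α j * (v j : ℝ) + 2 * f
      - Finset.univ.inf' Finset.univ_nonempty
          (fun σ : Equiv.Perm (Fin K) => ∑ j, α j * (v (σ j) : ℝ)) : ℝ) : EReal)

/-- The second moment `E (η̃^ε (X^ε; α))²`, where `X^ε = (X_1^ε, …, X_K^ε)` has independent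
components with `X_j^ε ∼ μ^{ε/α_j}`. -/
def secondMoment [NeZero K] [MeasurableSpace S] (μ : ℝ≥0∞ → Measure S) (g : ℝ≥0∞ → S → ℝ≥0)
    (Fε : ℝ → S → ℝ) (α : Fin K → ℝ) (ε : ℝ) : ℝ≥0∞ :=
  ∫⁻ x, ENNReal.ofReal (etaTilde g Fε α ε x ^ 2) ∂(Measure.pi fun j => μ (temp ε (α j)))

end Weights

end INS

end

/-!
Symmetrizing over the permutations of the sample shows that the second moment lies between
`E[ρ̃^ε(X^ε) e^{-2F^ε(X_1^ε)/ε}]` and `K!` times this expectation, so only the latter has to be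
evaluated by Laplace's method. Near a point `y` at which all rates are finite, `ρ̃^ε` behaves on the
exponential scale like `ρ^ε`, and the sample is near `y` with probability
`e^{-∑ j, α_j I(y_j)/ε}`; such a neighbourhood contributes with the exponent
`2 ∑ j, α_j I(y_j) + 2 F(y_1) - min_σ ∑ j, α_j I(y_{σ(j)})`, which gives the lower bound.

For the upper bound compactness is available only for the coordinates with `α_j > 0`, since the law
`μ^∞` of the others does not depend on `ε`. There `ρ̃^ε` is estimated by comparing the sample with
its permutations that fix all coordinates with `α_j = 0`: the density `g^∞` cancels in this
comparison. In `V_F` the rates `I_j` are at most `I_1`, whereas those of `y` are not constrained;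
some permutation of this kind still bounds the exponent from below by the cost of an admissible
vector.

Finally, along the decomposition of an admissible vector into its level sets the cost is additive,
so the infimum is approached by vectors with entries in `{0, I_1}`; these are rates of points of the
space because `I` vanishes somewhere.
-/

noncomputable section

namespace INS

section Cover

/-- A sequence which violates the property along `l ×ˢ 𝓝 y` stays in a compact set. -/
lemma eventually_prod_nhds_of_forall_isCompact {A Y : Type*} [TopologicalSpace Y]
    [FirstCountableTopology Y] {l : Filter A} [l.IsCountablyGenerated] {P : A → Y → Prop}
    (h : ∀ C : Set Y, IsCompact C → ∀ᶠ a in l, ∀ x ∈ C, P a x) (y : Y) :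
    ∀ᶠ p in l ×ˢ 𝓝 y, P p.1 p.2 := by
  by_contra hcon
  obtain ⟨u, hu, hP⟩ := exists_seq_forall_of_frequently (not_eventually.1 hcon)
  have h1 : Tendsto (fun n => (u n).1) atTop l := tendsto_fst.comp hu
  have h2 : Tendsto (fun n => (u n).2) atTop (𝓝 y) := tendsto_snd.comp hu
  obtain ⟨n, hn⟩ := (h1.eventually (h _ h2.isCompact_insert_range)).exists
  exact hP n (hn _ (Set.mem_insert_of_mem _ ⟨n, rfl⟩))

lemma exists_isClosed_pi_forall_of_eventually_prod_nhds {A ι X : Type*}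
    [TopologicalSpace X] [RegularSpace X] {l : Filter A} {P : A → (ι → X) → Prop} {y : ι → X}
    (h : ∀ᶠ p in l ×ˢ 𝓝 y, P p.1 p.2) {s : ι → Set X} (hs : ∀ j, s j ∈ 𝓝 (y j)) :
    ∃ N : ι → Set X, (∀ j, IsClosed (N j)) ∧ (∀ j, N j ∈ 𝓝 (y j)) ∧ (∀ j, N j ⊆ s j) ∧
      ∀ᶠ a in l, ∀ z ∈ Set.univ.pi N, P a z := by
  obtain ⟨pa, ha, pb, hb, hab⟩ := eventually_prod_iff.1 h
  rw [nhds_pi] at hb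
  obtain ⟨_, _, t, ht, htb⟩ := mem_pi.1 hb
  choose N hN hNc hNts using fun j =>
    exists_mem_nhds_isClosed_subset (inter_mem (ht j) (hs j))
  exact ⟨N, hNc, hN, fun j => (hNts j).trans Set.inter_subset_right,
    ha.mono fun a ha z hz => hab ha (htb fun j _ => (hNts j (hz j trivial)).1)⟩

lemma exists_nhds_of_le_nhdsSet {X : Type*} [TopologicalSpace X] {C : Set X}
    (hC : IsCompact C) {f : Ultrafilter X} (hf : ↑f ≤ 𝓝ˢ C) : ∃ x ∈ C, ↑f ≤ 𝓝 x := by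
  by_contra! hcon
  choose! U hU hUf using fun x hx => Filter.not_le.1 (hcon x hx)
  obtain ⟨t, ht, hCt⟩ := hC.elim_nhds_subcover (fun x => interior (U x)) fun x hx =>
    interior_mem_nhds.2 (hU x hx)
  have hmem : ⋃ x ∈ t, interior (U x) ∈ f :=
    hf ((isOpen_biUnion fun x _ => isOpen_interior).mem_nhdsSet.2 hCt)
  obtain ⟨x, hx, hxf⟩ := (Ultrafilter.finite_biUnion_mem_iff t.finite_toSet).1 hmem
  exact hUf x (ht x hx) (mem_of_superset hxf interior_subset)

/-- Tube lemma for powers of a compact set: an ultrafilter whose marginals converge to points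
of `C` converges to a point of the power of `C`. -/
lemma exists_isOpen_pi_subset {X ι : Type*} [TopologicalSpace X] [Finite ι] {C : Set X}
    (hC : IsCompact C) {O : Set (ι → X)} (hO : IsOpen O) (hCO : (Set.univ.pi fun _ => C) ⊆ O) :
    ∃ U, IsOpen U ∧ C ⊆ U ∧ (Set.univ.pi fun _ => U) ⊆ O := by
  have hOpi : O ∈ Filter.pi fun _ : ι => 𝓝ˢ C := by
    refine mem_iff_ultrafilter.2 fun f hf => ?_
    choose x hxC hx using fun i =>
      exists_nhds_of_le_nhdsSet hC (f := f.map fun z : ι → X => z i) (le_pi.1 hf i)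
    have hfx : ↑f ≤ 𝓝 x := by rw [nhds_pi]; exact le_pi.2 hx
    exact hfx (hO.mem_nhds (hCO fun i _ => hxC i))
  obtain ⟨_, _, t, ht, htO⟩ := mem_pi.1 hOpi
  choose U hU hCU hUt using fun i => mem_nhdsSet_iff_exists.1 (ht i)
  exact ⟨⋂ i, U i, isOpen_iInter_of_finite hU, Set.subset_iInter hCU,
    fun x hx => htO fun i _ => hUt i (Set.mem_iInter.1 (hx i trivial) i)⟩

lemma exists_finset_isOpen_cover_pi {X ι : Type*} [TopologicalSpace X] [Finite ι] {C : Set X}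
    (hC : IsCompact C) (hne : C.Nonempty) {N : (ι → X) → ι → Set X}
    (hN : ∀ y ∈ Set.univ.pi fun _ => C, ∀ j, N y j ∈ 𝓝 (y j)) (s : Set ι) :
    ∃ t : Finset (ι → X), (∀ y ∈ t, y ∈ Set.univ.pi fun _ => C) ∧ ∃ U, IsOpen U ∧ C ⊆ U ∧
      ∀ x : ι → X, (∀ j ∈ s, x j ∈ U) → ∃ y ∈ t, x ∈ s.pi (N y) := by
  classical
  obtain ⟨t, htC, hCt⟩ := (isCompact_univ_pi fun _ : ι => hC).elim_nhds_subcover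
    (fun y => interior (Set.univ.pi (N y))) fun y hy =>
      interior_mem_nhds.2 (set_pi_mem_nhds Set.finite_univ fun j _ => hN y hy j)
  obtain ⟨U, hU, hCU, hUt⟩ := exists_isOpen_pi_subset hC
    (isOpen_biUnion fun y _ => isOpen_interior) hCt
  obtain ⟨x₀, hx₀⟩ := hne
  refine ⟨t, htC, U, hU, hCU, fun x hx => ?_⟩
  have hz : s.piecewise x (fun _ => x₀) ∈ Set.univ.pi fun _ => U := fun j _ => by
    by_cases hj : j ∈ s
    · simpa [hj] using hx j hj
    · simpa [hj] using hCU hx₀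
  obtain ⟨y, hy, hzy⟩ := Set.mem_iUnion₂.1 (hUt hz)
  exact ⟨y, hy, fun j hj => by simpa [hj] using interior_subset hzy j trivial⟩

lemma measure_univ_le_card_mul {ι X : Type*} [Fintype ι] [MeasurableSpace X]
    {P : Measure (ι → X)} {t : Finset (ι → X)} {s : Set ι} {N : (ι → X) → ι → Set X} {U : Set X}
    (hcover : ∀ x : ι → X, (∀ j ∈ s, x j ∈ U) → ∃ y ∈ t, x ∈ s.pi (N y)) {c : ℝ≥0∞}
    (ht : ∀ y ∈ t, P (s.pi (N y)) ≤ c) (hU : ∀ j ∈ s, P (Function.eval j ⁻¹' Uᶜ) ≤ c) :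
    P Set.univ ≤ (t.card + Fintype.card ι : ℕ) * c := by
  classical
  have hsub : Set.univ ⊆ (⋃ y ∈ t, s.pi (N y)) ∪ ⋃ j ∈ s.toFinset, Function.eval j ⁻¹' Uᶜ :=
    fun x _ => by
      by_cases hx : ∀ j ∈ s, x j ∈ U
      · exact .inl (Set.mem_iUnion₂.2 (by simpa using hcover x hx))
      · exact .inr (by simpa using hx)
  calc P Set.univ
      ≤ ∑ y ∈ t, P (s.pi (N y)) + ∑ j ∈ s.toFinset, P (Function.eval j ⁻¹' Uᶜ) :=
        ((measure_mono hsub).trans (measure_union_le _ _)).trans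
          (add_le_add (measure_biUnion_finset_le _ _) (measure_biUnion_finset_le _ _))
    _ ≤ t.card • c + s.toFinset.card • c :=
        add_le_add (Finset.sum_le_card_nsmul _ _ _ ht)
          (Finset.sum_le_card_nsmul _ _ _ fun j hj => hU j (Set.mem_toFinset.1 hj))
    _ = (t.card + s.toFinset.card : ℕ) * c := by rw [← add_nsmul, nsmul_eq_mul]
    _ ≤ (t.card + Fintype.card ι : ℕ) * c := by gcongr; exact Finset.card_le_univ _

end Cover

section ExponentialScale

/-- The exponential scale `e ^ (-r / ε)` on which large deviation estimates of rate `r` live,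
with values in `ℝ≥0∞` to be compared with probabilities. -/
def expDecay (r ε : ℝ) : ℝ≥0∞ := ENNReal.ofReal (Real.exp (-r / ε))

lemma expDecay_add (r s ε : ℝ) : expDecay (r + s) ε = expDecay r ε * expDecay s ε := by
  rw [expDecay, expDecay, expDecay, ← ENNReal.ofReal_mul (Real.exp_nonneg _), ← Real.exp_add]
  ring_nf

lemma expDecay_sum {ι : Type*} (s : Finset ι) (r : ι → ℝ) (ε : ℝ) :
    expDecay (∑ i ∈ s, r i) ε = ∏ i ∈ s, expDecay (r i) ε := by
  simp only [expDecay, ← ENNReal.ofReal_prod_of_nonneg fun _ _ => Real.exp_nonneg _,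
    ← Real.exp_sum, ← Finset.sum_div, Finset.sum_neg_distrib]

lemma expDecay_anti {r s ε : ℝ} (hε : 0 < ε) (hrs : r ≤ s) : expDecay s ε ≤ expDecay r ε :=
  ENNReal.ofReal_le_ofReal (Real.exp_le_exp.2 (by gcongr))

lemma expDecay_div (r ε α : ℝ) : expDecay r (ε / α) = expDecay (α * r) ε := by
  rw [expDecay, expDecay, div_div_eq_mul_div, neg_mul, mul_comm]

lemma eventually_le_exp_div (c : ℝ) {δ : ℝ} (hδ : 0 < δ) :
    ∀ᶠ ε in 𝓝[>] (0 : ℝ), c ≤ Real.exp (δ / ε) := by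
  have h : Tendsto (fun ε : ℝ => Real.exp (δ / ε)) (𝓝[>] 0) atTop := by
    simp_rw [div_eq_mul_inv]
    exact Real.tendsto_exp_atTop.comp (tendsto_inv_nhdsGT_zero.const_mul_atTop hδ)
  exact h.eventually_ge_atTop c

lemma eventually_natCast_mul_expDecay_le (n : ℕ) {r s : ℝ} (hrs : r < s) :
    ∀ᶠ ε in 𝓝[>] (0 : ℝ), n * expDecay s ε ≤ expDecay r ε := by
  filter_upwards [eventually_le_exp_div n (sub_pos.2 hrs)] with ε h
  have hsplit : expDecay r ε = ENNReal.ofReal (Real.exp ((s - r) / ε)) * expDecay s ε := by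
    rw [expDecay, expDecay, ← ENNReal.ofReal_mul (Real.exp_nonneg _), ← Real.exp_add]
    ring_nf
  rw [hsplit, ← ENNReal.ofReal_natCast]
  gcongr

lemma eventually_expDecay_le {r : ℝ} (hr : 0 < r) {c : ℝ≥0∞} (hc : c ≠ 0) :
    ∀ᶠ ε in 𝓝[>] (0 : ℝ), expDecay r ε ≤ c := by
  have hexp : Tendsto (fun ε : ℝ => Real.exp (-r / ε)) (𝓝[>] 0) (𝓝 0) := by
    simp_rw [div_eq_mul_inv]
    exact Real.tendsto_exp_atBot.comp
      (tendsto_inv_nhdsGT_zero.const_mul_atTop_of_neg (neg_neg_of_pos hr))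
  have hlim : Tendsto (expDecay r) (𝓝[>] 0) (𝓝 0) := by
    rw [← ENNReal.ofReal_zero]
    exact ENNReal.tendsto_ofReal hexp
  exact hlim.eventually_le_const hc.bot_lt

lemma mul_log_le_neg_iff {ε : ℝ} (hε : 0 < ε) (m : ℝ≥0∞) (r : ℝ) :
    (ε : EReal) * ENNReal.log m ≤ -(r : EReal) ↔ m ≤ expDecay r ε := by
  rw [expDecay, ← ENNReal.log_le_log_iff (x := m), ENNReal.log_ofReal_of_pos (Real.exp_pos _),
    Real.log_exp, EReal.coe_div, EReal.le_div_iff_mul_le (by exact_mod_cast hε)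
    (EReal.coe_ne_top _), mul_comm, EReal.coe_neg]

lemma neg_le_mul_log_iff {ε : ℝ} (hε : 0 < ε) (m : ℝ≥0∞) (r : ℝ) :
    -(r : EReal) ≤ (ε : EReal) * ENNReal.log m ↔ expDecay r ε ≤ m := by
  rw [expDecay, ← ENNReal.log_le_log_iff (y := m), ENNReal.log_ofReal_of_pos (Real.exp_pos _),
    Real.log_exp, EReal.coe_div, EReal.div_le_iff_le_mul (by exact_mod_cast hε)
    (EReal.coe_ne_top _), EReal.coe_neg]

lemma tendsto_neg_mul_log {m : ℝ → ℝ≥0∞} {L : EReal}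
    (hu : ∀ r : ℝ, (r : EReal) < L → ∀ᶠ ε in 𝓝[>] (0 : ℝ), m ε ≤ expDecay r ε)
    (hl : ∀ r : ℝ, L < r → ∀ᶠ ε in 𝓝[>] (0 : ℝ), expDecay r ε ≤ m ε) :
    Tendsto (fun ε : ℝ => -(ε : EReal) * ENNReal.log (m ε)) (𝓝[>] 0) (𝓝 L) := by
  simp only [EReal.neg_mul]
  refine tendsto_order.2 ⟨fun a ha => ?_, fun a ha => ?_⟩
  · obtain ⟨r, har, hrL⟩ := EReal.lt_iff_exists_real_btwn.1 ha
    filter_upwards [hu r hrL, self_mem_nhdsWithin] with ε h hε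
    exact har.trans_le (EReal.le_neg_of_le_neg ((mul_log_le_neg_iff hε _ _).2 h))
  · obtain ⟨r, hLr, hra⟩ := EReal.lt_iff_exists_real_btwn.1 ha
    filter_upwards [hl r hLr, self_mem_nhdsWithin] with ε h hε
    exact (EReal.neg_le_of_neg_le ((neg_le_mul_log_iff hε _ _).2 h)).trans_lt hra

end ExponentialScale

section LDP

variable {S : Type*} [TopologicalSpace S] {I : S → ℝ≥0∞}

lemma IsRateFunction.lowerSemicontinuous [T2Space S] (h : IsRateFunction I) :
    LowerSemicontinuous I :=
  lowerSemicontinuous_iff_isClosed_preimage.2 fun a => by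
    induction a with
    | top => simp
    | coe a => exact (h a).isClosed

lemma exists_nhds_abs_toReal_sub_le (hI : ContinuousOn I {x | I x ≠ ∞}) {y : S} (hy : I y ≠ ∞)
    {δ : ℝ} (hδ : 0 < δ) : ∃ N ∈ 𝓝 y, ∀ x ∈ N, I x ≠ ∞ → |(I x).toReal - (I y).toReal| ≤ δ := by
  have h : ContinuousWithinAt (fun x => (I x).toReal) {x | I x ≠ ∞} y :=
    (ENNReal.tendsto_toReal hy).comp (hI y hy)
  exact ⟨_, eventually_nhdsWithin_iff.1 (h.eventually (Metric.closedBall_mem_nhds _ hδ)),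
    fun _ hx => hx⟩

variable [MeasurableSpace S] {ν : ℝ → Measure S}

lemma SatisfiesLDP.eventually_le_expDecay (h : SatisfiesLDP ν I) {C : Set S} (hC : IsClosed C)
    {a b : ℝ} (hI : ∀ x ∈ C, I x ≠ ∞ → a ≤ (I x).toReal) (hb : b < a) :
    ∀ᶠ ε in 𝓝[>] (0 : ℝ), ν ε C ≤ expDecay b ε := by
  have hinf : (a : EReal) ≤ ⨅ x ∈ C, (I x : EReal) := le_iInf₂ fun x hx => by
    by_cases hIx : I x = ∞
    · simp [hIx]
    · rw [← EReal.coe_toReal (x := (I x : EReal)) (by simpa) (by simp)]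
      simpa using hI x hx hIx
  have hlimsup : limsup (fun ε : ℝ => (ε : EReal) * ENNReal.log (ν ε C)) (𝓝[>] 0) < -(b : EReal) :=
    (h.upper C hC).trans_lt
      (EReal.neg_lt_neg_iff.2 ((EReal.coe_lt_coe_iff.2 hb).trans_le hinf))
  filter_upwards [eventually_lt_of_limsup_lt hlimsup, self_mem_nhdsWithin] with ε hlt hε
  exact (mul_log_le_neg_iff hε _ _).1 hlt.le

lemma SatisfiesLDP.eventually_expDecay_le (h : SatisfiesLDP ν I) {U : Set S} (hU : IsOpen U)
    {x : S} (hx : x ∈ U) (hIx : I x ≠ ∞) {b : ℝ} (hb : (I x).toReal < b) :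
    ∀ᶠ ε in 𝓝[>] (0 : ℝ), expDecay b ε ≤ ν ε U := by
  have hinf : ⨅ x ∈ U, (I x : EReal) < (b : EReal) := (iInf₂_le x hx).trans_lt (by
    rw [← EReal.coe_toReal (x := (I x : EReal)) (by simpa) (by simp)]
    simpa using hb)
  have hliminf := (EReal.neg_lt_neg_iff.2 hinf).trans_le (h.lower U hU)
  filter_upwards [eventually_lt_of_lt_liminf hliminf, self_mem_nhdsWithin] with ε hlt hε
  exact (neg_le_mul_log_iff hε _ _).1 hlt.le

lemma SatisfiesLDP.exists_toReal_lt (h : SatisfiesLDP ν I)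
    (hν : ∀ ε, 0 < ε → IsProbabilityMeasure (ν ε)) {a : ℝ} (ha : 0 < a) :
    ∃ x, I x ≠ ∞ ∧ (I x).toReal < a := by
  by_contra! hcon
  obtain ⟨ε, hle, hε⟩ := ((h.eventually_le_expDecay isClosed_univ (fun x _ => hcon x)
    (half_lt_self ha)).and self_mem_nhdsWithin).exists
  have := hν ε hε
  refine hle.not_gt ?_
  rw [measure_univ, expDecay, ENNReal.ofReal_lt_one, Real.exp_lt_one_iff, neg_div, neg_lt_zero]
  exact div_pos (half_pos ha) hε

lemma SatisfiesLDP.exists_eq_zero [T2Space S] (h : SatisfiesLDP ν I)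
    (hν : ∀ ε, 0 < ε → IsProbabilityMeasure (ν ε)) : ∃ x, I x = 0 := by
  obtain ⟨x, hx, hx1⟩ := h.exists_toReal_lt hν one_pos
  have hmem : ∀ {z}, I z ≠ ∞ → (I z).toReal < 1 → z ∈ {x | I x ≤ (1 : ℝ≥0)} := fun hz hz1 => by
    simpa using (ENNReal.toReal_le_toReal hz ENNReal.one_ne_top).1 (by simpa using hz1.le)
  obtain ⟨y, hy, hmin⟩ := LowerSemicontinuousOn.exists_isMinOn ⟨x, hmem hx hx1⟩ (h.rate 1)
    (h.rate.lowerSemicontinuous.lowerSemicontinuousOn _)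
  have hyt : I y ≠ ∞ := ne_top_of_le_ne_top ENNReal.coe_ne_top hy
  by_contra! hne
  have hpos : 0 < (I y).toReal := ENNReal.toReal_pos (hne y) hyt
  obtain ⟨z, hz, hzlt⟩ := h.exists_toReal_lt hν (lt_min one_pos hpos)
  have hyz : I y ≤ I z := hmin (hmem hz (hzlt.trans_le (min_le_left _ _)))
  exact (hzlt.trans_le (min_le_right _ _)).not_ge (ENNReal.toReal_mono hz hyz)

end LDP

section Temperature

lemma temp_of_nonpos {ε α : ℝ} (hε : 0 < ε) (hα : α ≤ 0) : temp ε α = ∞ := by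
  rw [temp, ENNReal.ofReal_of_nonpos hα, ENNReal.div_zero (ENNReal.ofReal_pos.2 hε).ne']

lemma temp_of_pos (ε : ℝ) {α : ℝ} (hα : 0 < α) : temp ε α = ENNReal.ofReal (ε / α) :=
  (ENNReal.ofReal_div_of_pos hα).symm

lemma eventually_temp {p : ℝ → ℝ≥0∞ → Prop} {α : ℝ} (hα : 0 < α)
    (h : ∀ᶠ ε in 𝓝[>] (0 : ℝ), p ε (ENNReal.ofReal ε)) :
    ∀ᶠ ε in 𝓝[>] (0 : ℝ), p (ε / α) (temp ε α) := by
  have hdiv : Tendsto (fun ε : ℝ => ε / α) (𝓝[>] 0) (𝓝[>] 0) := by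
    refine tendsto_nhdsWithin_iff.2 ⟨?_, ?_⟩
    · exact tendsto_nhdsWithin_of_tendsto_nhds
        (Continuous.tendsto' (by fun_prop) _ _ (zero_div α))
    · filter_upwards [self_mem_nhdsWithin] with ε hε using div_pos hε hα
  simpa only [temp_of_pos _ hα] using hdiv.eventually h

variable {S : Type*} [TopologicalSpace S] [MeasurableSpace S] {μ : ℝ≥0∞ → Measure S}
  {I : S → ℝ≥0∞}

lemma eventually_measure_temp_le (h : SatisfiesLDP (fun ε => μ (ENNReal.ofReal ε)) I) {α : ℝ}
    (hα : 0 < α) {C : Set S} (hC : IsClosed C) {a b : ℝ}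
    (hI : ∀ x ∈ C, I x ≠ ∞ → a ≤ (I x).toReal) (hb : b < a) :
    ∀ᶠ ε in 𝓝[>] (0 : ℝ), μ (temp ε α) C ≤ expDecay (α * b) ε := by
  simp only [← expDecay_div]
  exact eventually_temp (p := fun ε t => μ t C ≤ expDecay b ε) hα
    (h.eventually_le_expDecay hC hI hb)

lemma eventually_le_measure_temp (h : SatisfiesLDP (fun ε => μ (ENNReal.ofReal ε)) I) {α : ℝ}
    (hα : 0 < α) {U : Set S} (hU : IsOpen U) {x : S} (hx : x ∈ U) (hIx : I x ≠ ∞) {b : ℝ}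
    (hb : (I x).toReal < b) :
    ∀ᶠ ε in 𝓝[>] (0 : ℝ), expDecay (α * b) ε ≤ μ (temp ε α) U := by
  simp only [← expDecay_div]
  exact eventually_temp (p := fun ε t => expDecay b ε ≤ μ t U) hα
    (h.eventually_expDecay_le hU hx hIx hb)

end Temperature

section Cost

variable {ι : Type*}

lemma exists_perm_antivary [Finite ι] (α v : ι → ℝ) : ∃ σ : Equiv.Perm ι, Antivary α (v ∘ σ) := by
  let e := Finite.equivFin ι
  let a := (Tuple.sort (α ∘ e.symm)).trans e.symm
  let b := (Tuple.sort (v ∘ e.symm)).trans e.symm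
  have ha : Monotone (α ∘ a) := Tuple.monotone_sort (α ∘ e.symm)
  have hb : Monotone (v ∘ b) := Tuple.monotone_sort (v ∘ e.symm)
  have h : Antivary (α ∘ a) (v ∘ b ∘ Fin.rev) :=
    ha.antivary (hb.comp_antitone Fin.rev_anti)
  refine ⟨a.symm.trans (Fin.revPerm.trans b), ?_⟩
  simpa [Function.comp_def] using h.comp_right a.symm

lemma exists_perm_antivaryOn [Finite ι] (α v : ι → ℝ) (s : Set ι) :
    ∃ σ : Equiv.Perm ι, (∀ j ∉ s, σ j = j) ∧ AntivaryOn α (v ∘ σ) s := by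
  classical
  obtain ⟨σ, hσ⟩ := exists_perm_antivary (fun j : s => α j) fun j : s => v j
  refine ⟨Equiv.Perm.ofSubtype σ, fun j hj => Equiv.Perm.ofSubtype_apply_of_not_mem σ hj, ?_⟩
  intro i hi j hj hij
  simp only [Function.comp_apply, Equiv.Perm.ofSubtype_apply_of_mem σ hi,
    Equiv.Perm.ofSubtype_apply_of_mem σ hj] at hij
  exact hσ hij

lemma exists_perm_antivary_fixing_zeros [Finite ι] {α v : ι → ℝ} {R : ℝ} (hα : ∀ j, 0 ≤ α j)
    (hR : ∀ j, v j ≤ R) :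
    ∃ τ : Equiv.Perm ι, (∀ j, α j = 0 → τ j = j) ∧ (∀ j, 0 < α j → 0 < α (τ j)) ∧
      Antivary α ((fun j => if α j = 0 then R else v j) ∘ τ) := by
  obtain ⟨τ, hτ, hanti⟩ := exists_perm_antivaryOn α v {j | 0 < α j}
  have hfix : ∀ j, α j = 0 → τ j = j := fun j hj => hτ j (by simp [hj])
  have hmaps : ∀ j, 0 < α j → 0 < α (τ j) := fun j hj => by
    by_contra hτj
    exact hτj (by rwa [τ.injective (hτ (τ j) hτj)])
  refine ⟨τ, hfix, hmaps, fun j k hjk => ?_⟩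
  rcases (hα k).eq_or_lt with hk | hk
  · exact hk ▸ hα j
  simp only [Function.comp_apply, if_neg (hmaps k hk).ne'] at hjk
  rcases (hα j).eq_or_lt with hj | hj
  · rw [hfix j hj.symm, if_pos hj.symm] at hjk
    exact absurd (hR _) hjk.not_ge
  · rw [if_neg (hmaps j hj).ne'] at hjk
    exact hanti hj hk hjk

variable [Fintype ι] [DecidableEq ι] {α : ι → ℝ}

/-- The minimal value of `∑ j, α j * v (σ j)` over the permutations `σ`. -/
def minCost (α v : ι → ℝ) : ℝ :=
  Finset.univ.inf' Finset.univ_nonempty (fun σ : Equiv.Perm ι => ∑ j, α j * v (σ j))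

/-- The contribution `2 ∑ j, α j * v j - min_σ ∑ j, α j * v (σ j)` of the vector `v` of rates to
the decay rate of the second moment. -/
def cost (α v : ι → ℝ) : ℝ := 2 * ∑ j, α j * v j - minCost α v

lemma minCost_le (α v : ι → ℝ) (σ : Equiv.Perm ι) : minCost α v ≤ ∑ j, α j * v (σ j) :=
  Finset.inf'_le _ (Finset.mem_univ σ)

lemma minCost_eq_of_antivary {v : ι → ℝ} {σ : Equiv.Perm ι} (hσ : Antivary α (v ∘ σ)) :
    minCost α v = ∑ j, α j * v (σ j) := by
  refine le_antisymm (minCost_le α v σ) (Finset.le_inf' _ _ fun τ _ => ?_)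
  simpa using hσ.sum_mul_le_sum_mul_comp_perm (σ := σ⁻¹ * τ)

lemma cost_nonneg (hα : ∀ j, 0 ≤ α j) {v : ι → ℝ} (hv : ∀ j, 0 ≤ v j) : 0 ≤ cost α v := by
  have hmin : minCost α v ≤ ∑ j, α j * v j := minCost_le α v 1
  have hsum : 0 ≤ ∑ j, α j * v j := Finset.sum_nonneg fun j _ => mul_nonneg (hα j) (hv j)
  unfold cost
  linarith

/-- The vectors `φ ∘ v` and `ψ ∘ v` are ordered alike, so one permutation is optimal for both. -/
lemma cost_comp_add {φ ψ : ℝ → ℝ} (hφ : Monotone φ) (hψ : Monotone ψ) (v : ι → ℝ) :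
    cost α (fun j => φ (v j) + ψ (v j)) = cost α (φ ∘ v) + cost α (ψ ∘ v) := by
  obtain ⟨σ, hσ⟩ := exists_perm_antivary α v
  have key : ∀ {θ : ℝ → ℝ}, Monotone θ → Antivary α ((θ ∘ v) ∘ σ) := fun hθ i j hij =>
    hσ (hθ.reflect_lt hij)
  have hadd := minCost_eq_of_antivary (key (hφ.add hψ))
  simp only [cost, minCost_eq_of_antivary (key hφ), minCost_eq_of_antivary (key hψ)]
  simp only [Function.comp_def] at hadd ⊢
  simp only [hadd, mul_add, Finset.sum_add_distrib]
  ring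

lemma cost_const_mul {s : ℝ} (hs : 0 ≤ s) (v : ι → ℝ) :
    cost α (fun j => s * v j) = s * cost α v := by
  obtain ⟨σ, hσ⟩ := exists_perm_antivary α v
  have hσs : Antivary α ((fun j => s * v j) ∘ σ) := fun i j hij =>
    hσ (lt_of_mul_lt_mul_left hij hs)
  simp only [cost, minCost_eq_of_antivary hσ, minCost_eq_of_antivary hσs, mul_left_comm _ s,
    ← Finset.mul_sum]
  ring

lemma cost_eq_cost_min_add_cost_max (s : ℝ) (v : ι → ℝ) :
    cost α v = cost α (fun j => min (v j) s) + cost α (fun j => max (v j - s) 0) := by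
  have hsplit : ∀ t : ℝ, t = min t s + max (t - s) 0 := fun t => by
    rcases le_total t s with h | h <;> simp [h]
  conv_lhs => rw [funext fun j => hsplit (v j)]
  exact cost_comp_add (φ := fun t => min t s) (ψ := fun t => max (t - s) 0)
    (fun _ _ h => min_le_min_right _ h) (fun _ _ h => max_le_max_right _ (sub_le_sub_right h _)) v

lemma cost_min_le (hα : ∀ j, 0 ≤ α j) (s : ℝ) (v : ι → ℝ) :
    cost α (fun j => min (v j) s) ≤ cost α v := by
  rw [cost_eq_cost_min_add_cost_max s v]
  exact le_add_of_nonneg_right (cost_nonneg hα fun j => le_max_right _ _)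

/-- Peel off the layer `{j | 0 < v j}` at the height of the least positive entry `v k`, on which
the cost is that of `v k` times an indicator; the rest has smaller support. -/
lemma mul_le_cost_of_forall_indicator (hα : ∀ j, 0 ≤ α j) {i : ι} {c : ℝ}
    (hc : ∀ B : Finset ι, i ∈ B → c ≤ cost α (fun j => if j ∈ B then 1 else 0))
    {v : ι → ℝ} (hv : ∀ j, 0 ≤ v j) : v i * c ≤ cost α v := by
  induction hn : (Finset.univ.filter fun j => 0 < v j).card using Nat.strong_induction_on
    generalizing v with
  | _ n ih =>
  subst hn
  rcases (hv i).eq_or_lt with hvi | hvi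
  · simpa only [← hvi, zero_mul] using cost_nonneg hα hv
  set B := Finset.univ.filter fun j => 0 < v j with hB
  have hiB : i ∈ B := by simp [hB, hvi]
  obtain ⟨k, hkB, hk⟩ := B.exists_min_image v ⟨i, hiB⟩
  have hk0 : 0 < v k := by simpa [hB] using hkB
  have hlayer : (fun j => min (v j) (v k)) = fun j => v k * if j ∈ B then 1 else 0 := by
    funext j
    by_cases hj : j ∈ B
    · simp [hj, hk j hj]
    · have hvj : v j = 0 := le_antisymm (by simpa [hB] using hj) (hv j)
      simp [hj, hvj, hk0.le]
  have hcard : (Finset.univ.filter fun j => 0 < max (v j - v k) 0).card < B.card := by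
    refine Finset.card_lt_card ((Finset.ssubset_iff_of_subset fun j hj => ?_).2 ⟨k, hkB, by simp⟩)
    simp only [hB, Finset.mem_filter_univ, lt_max_iff, lt_irrefl, or_false] at hj ⊢
    linarith
  have hrest : (v i - v k) * c ≤ cost α fun j => max (v j - v k) 0 := by
    simpa only [max_eq_left (sub_nonneg.2 (hk i hiB))]
      using ih _ hcard (v := fun j => max (v j - v k) 0) (fun j => le_max_right _ _) rfl
  calc v i * c = v k * c + (v i - v k) * c := by ring
    _ ≤ v k * cost α (fun j => if j ∈ B then 1 else 0) + cost α (fun j => max (v j - v k) 0) :=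
        add_le_add (mul_le_mul_of_nonneg_left (hc B hiB) hk0.le) hrest
    _ = cost α v := by
        rw [cost_eq_cost_min_add_cost_max (v k) v, hlayer, cost_const_mul hk0.le]

lemma exists_mul_cost_indicator_le (hα : ∀ j, 0 ≤ α j) (i : ι) {v : ι → ℝ} (hv : ∀ j, 0 ≤ v j) :
    ∃ B : Finset ι, i ∈ B ∧ v i * cost α (fun j => if j ∈ B then 1 else 0) ≤ cost α v := by
  obtain ⟨B, hB, hmin⟩ := (Finset.univ.filter fun B : Finset ι => i ∈ B).exists_min_image
    (fun B => cost α fun j => if j ∈ B then 1 else 0) ⟨{i}, by simp⟩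
  exact ⟨B, by simpa using hB,
    mul_le_cost_of_forall_indicator hα (fun B' hB' => hmin B' (by simpa using hB')) hv⟩

/-- The entries of `v` with `α j = 0` are irrelevant on the right. Raised to a common large value
they may be left in place by an optimal permutation, and truncation at `v i` lowers the cost. -/
lemma exists_perm_cost_le (hα : ∀ j, 0 ≤ α j) {i : ι} (hi : 0 < α i) {v : ι → ℝ}
    (hv : ∀ j, 0 ≤ v j) :
    ∃ (τ : Equiv.Perm ι) (w : ι → ℝ), (∀ j, α j = 0 → τ j = j) ∧ (∀ j, 0 ≤ w j ∧ w j ≤ w i) ∧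
      w i = v i ∧ cost α w ≤ 2 * ∑ j, α j * v j - ∑ j, α j * v (τ j) := by
  have hR : ∀ j, v j ≤ ∑ k, v k := fun j =>
    Finset.single_le_sum (fun k _ => hv k) (Finset.mem_univ j)
  obtain ⟨τ, hfix, hmaps, hanti⟩ := exists_perm_antivary_fixing_zeros hα hR
  set u : ι → ℝ := fun j => if α j = 0 then ∑ k, v k else v j with hu
  have hu0 : ∀ j, 0 ≤ u j := fun j => by
    simp only [hu]; split_ifs; exacts [(hv j).trans (hR j), hv j]
  have hsum : ∀ σ : Equiv.Perm ι, (∀ j, 0 < α j → 0 < α (σ j)) →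
      ∑ j, α j * u (σ j) = ∑ j, α j * v (σ j) := fun σ hσ => Finset.sum_congr rfl fun j _ => by
    rcases (hα j).eq_or_lt with hj | hj
    · simp only [← hj, zero_mul]
    · simp only [hu, if_neg (hσ j hj).ne']
  refine ⟨τ, fun j => min (u j) (u i), hfix, fun j => ⟨le_min (hu0 j) (hu0 i), by simp⟩,
    by simp [hu, hi.ne'], (cost_min_le hα _ u).trans (le_of_eq ?_)⟩
  rw [cost, minCost_eq_of_antivary hanti]
  exact congrArg₂ _ (congrArg _ (hsum 1 fun j hj => hj)) (hsum τ hmaps)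

end Cost

section Infimum

variable {K : ℕ} [NeZero K] {α : Fin K → ℝ} {S : Type*} {I : S → ℝ≥0∞} {F : S → ℝ}

lemma V_le_cost_add {w : Fin K → ℝ} (hw : ∀ j, 0 ≤ w j ∧ w j ≤ w 0) {x : S} (hx : I x ≠ ∞)
    (hwx : w 0 = (I x).toReal) : V I F α ≤ ((cost α w + 2 * F x : ℝ) : EReal) := by
  have hmem : (((w 0).toNNReal : ℝ≥0∞), F x) ∈ Set.range fun x => (I x, F x) :=
    ⟨x, Prod.ext (by rw [hwx]; exact (ENNReal.ofReal_toReal hx).symm) rfl⟩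
  refine (iInf₂_le (fun j => (w j).toNNReal) (F x)).trans
    ((iInf₂_le hmem fun j => Real.toNNReal_le_toNNReal (hw j).2).trans (le_of_eq ?_))
  simp only [Real.coe_toNNReal _ (hw _).1, cost, minCost]
  ring_nf

lemma exists_cost_indicator_lt_of_V_lt (hα : ∀ j, 0 ≤ α j) {r : ℝ} (hr : V I F α < r) :
    ∃ (x : S) (B : Finset (Fin K)), I x ≠ ∞ ∧ 0 ∈ B ∧
      cost α (fun j => if j ∈ B then (I x).toReal else 0) + 2 * F x < r := by
  simp only [V, iInf_lt_iff] at hr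
  obtain ⟨v, f, ⟨x, hx⟩, -, hr⟩ := hr
  obtain ⟨hIx, rfl⟩ : I x = v 0 ∧ F x = f := Prod.ext_iff.1 hx
  obtain ⟨B, hB, hle⟩ := exists_mul_cost_indicator_le hα 0 (v := fun j => (v j : ℝ))
    fun j => NNReal.coe_nonneg _
  refine ⟨x, B, by simp [hIx], hB, ?_⟩
  have hscale : (fun j => if j ∈ B then (I x).toReal else 0)
      = fun j => (v 0 : ℝ) * if j ∈ B then 1 else 0 := by
    funext j; simp [hIx]
  rw [hscale, cost_const_mul (NNReal.coe_nonneg _)]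
  have hlt := EReal.coe_lt_coe_iff.1 hr
  simp only [cost, minCost] at hle hlt ⊢
  linarith

end Infimum

section ProductDensity

variable {S : Type*} [MeasurableSpace S] {γ : Measure S} [SigmaFinite γ] {n : ℕ}

lemma lintegral_pi_prod {f : Fin n → S → ℝ≥0∞} (hf : ∀ i, Measurable (f i)) :
    ∫⁻ x, ∏ i, f i (x i) ∂(Measure.pi fun _ : Fin n => γ) = ∏ i, ∫⁻ x, f i x ∂γ := by
  induction n with
  | zero => simp
  | succ n ih =>
    have hm := (measurePreserving_piFinSuccAbove (fun _ : Fin (n + 1) => γ) 0).symm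
    rw [← hm.lintegral_comp (by fun_prop)]
    simp only [MeasurableEquiv.piFinSuccAbove_symm_apply, Fin.insertNthEquiv, Equiv.coe_fn_mk,
      Fin.insertNth_zero', Fin.prod_univ_succ, Fin.cons_zero, Fin.cons_succ]
    rw [lintegral_prod_mul (g := fun x : Fin n → S => ∏ i, f i.succ (x i)) (hf 0).aemeasurable
      (Finset.measurable_fun_prod _ fun i _ =>
        (hf i.succ).comp (measurable_pi_apply i)).aemeasurable, ih fun i => hf i.succ]

lemma pi_withDensity {f : Fin n → S → ℝ≥0∞} (hf : ∀ i, Measurable (f i))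
    [∀ i, SigmaFinite (γ.withDensity (f i))] :
    Measure.pi (fun i => γ.withDensity (f i))
      = (Measure.pi fun _ : Fin n => γ).withDensity fun x => ∏ i, f i (x i) := by
  refine Measure.pi_eq fun s hs => ?_
  have h : ((Set.univ.pi s).indicator fun x : Fin n → S => ∏ i, f i (x i))
      = fun x => ∏ i, (s i).indicator (f i) (x i) := by
    funext x
    by_cases hx : x ∈ Set.univ.pi s
    · rw [Set.indicator_of_mem hx]
      exact Finset.prod_congr rfl fun i _ => (Set.indicator_of_mem (hx i trivial) _).symm
    · obtain ⟨i, hi⟩ : ∃ i, x i ∉ s i := by simpa [Set.mem_pi] using hx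
      rw [Set.indicator_of_notMem hx]
      exact (Finset.prod_eq_zero (Finset.mem_univ i) (Set.indicator_of_notMem hi _)).symm
  rw [withDensity_apply _ (.univ_pi hs), ← lintegral_indicator (.univ_pi hs), h,
    lintegral_pi_prod fun i => (hf i).indicator (hs i)]
  exact Finset.prod_congr rfl fun i _ => by
    rw [lintegral_indicator (hs i), withDensity_apply _ (hs i)]

lemma lintegral_pi_comp_perm (σ : Equiv.Perm (Fin n)) {f : (Fin n → S) → ℝ≥0∞}
    (hf : Measurable f) :
    ∫⁻ x, f (x ∘ σ) ∂(Measure.pi fun _ : Fin n => γ)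
      = ∫⁻ x, f x ∂(Measure.pi fun _ : Fin n => γ) := by
  have h := measurePreserving_piCongrLeft (fun _ : Fin n => γ) σ.symm
  rw [← h.lintegral_comp hf]
  refine lintegral_congr fun x => congrArg f (funext fun j => ?_)
  simpa using (MeasurableEquiv.piCongrLeft_apply_apply (β := fun _ : Fin n => S) σ.symm x
    (σ j)).symm

end ProductDensity

section SymWeight

variable {S : Type*} {K : ℕ} {w : (Fin K → S) → ℝ}

lemma sum_perm_comp_perm (w : (Fin K → S) → ℝ) (x : Fin K → S) (σ : Equiv.Perm (Fin K)) :
    ∑ τ : Equiv.Perm (Fin K), w (fun j => (x ∘ σ) (τ j))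
      = ∑ τ : Equiv.Perm (Fin K), w (fun j => x (τ j)) :=
  Fintype.sum_equiv (Equiv.mulLeft σ) _ _ fun _ => rfl

lemma le_sum_perm (hw : ∀ x, 0 ≤ w x) (x : Fin K → S) (σ : Equiv.Perm (Fin K)) :
    w (x ∘ σ) ≤ ∑ τ : Equiv.Perm (Fin K), w (fun j => x (τ j)) :=
  Finset.single_le_sum (f := fun τ : Equiv.Perm (Fin K) => w (fun j => x (τ j)))
    (fun _ _ => hw _) (Finset.mem_univ σ)

lemma symWeight_nonneg (hw : ∀ x, 0 ≤ w x) (x : Fin K → S) : 0 ≤ symWeight w x :=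
  div_nonneg (hw x) (Finset.sum_nonneg fun _ _ => hw _)

lemma symWeight_le_one (hw : ∀ x, 0 ≤ w x) (x : Fin K → S) : symWeight w x ≤ 1 :=
  div_le_one_of_le₀ (le_sum_perm hw x 1) (Finset.sum_nonneg fun _ _ => hw _)

lemma symWeight_mul_sum_perm (hw : ∀ x, 0 ≤ w x) (x : Fin K → S) :
    symWeight w x * ∑ τ : Equiv.Perm (Fin K), w (fun j => x (τ j)) = w x :=
  div_mul_cancel_of_imp fun h => le_antisymm (h ▸ le_sum_perm hw x 1) (hw x)

lemma symWeight_eq_zero_iff (hw : ∀ x, 0 ≤ w x) (x : Fin K → S) :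
    symWeight w x = 0 ↔ w x = 0 :=
  ⟨fun h => by rw [← symWeight_mul_sum_perm hw x, h, zero_mul], fun h => by simp [symWeight, h]⟩

lemma symWeight_mul_comp_perm_le (hw : ∀ x, 0 ≤ w x) (x : Fin K → S) (σ : Equiv.Perm (Fin K)) :
    symWeight w x * w (x ∘ σ) ≤ w x :=
  (mul_le_mul_of_nonneg_left (le_sum_perm hw x σ) (symWeight_nonneg hw x)).trans_eq
    (symWeight_mul_sum_perm hw x)

lemma mul_symWeight_comp_perm_le_iff (hw : ∀ x, 0 ≤ w x) {x : Fin K → S} (hx : w x ≠ 0)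
    (σ : Equiv.Perm (Fin K)) (t : ℝ) :
    t * symWeight w (x ∘ σ) ≤ symWeight w x ↔ t * w (x ∘ σ) ≤ w x := by
  have hpos : 0 < ∑ τ : Equiv.Perm (Fin K), w (fun j => x (τ j)) :=
    ((hw x).lt_of_ne' hx).trans_le (le_sum_perm hw x 1)
  rw [symWeight, symWeight, sum_perm_comp_perm, ← mul_div_assoc,
    div_le_div_iff_of_pos_right hpos]

variable [MeasurableSpace S]

lemma measurable_symWeight (hw : Measurable w) : Measurable (symWeight w) := by
  unfold symWeight
  fun_prop

lemma measurable_comp_perm (σ : Equiv.Perm (Fin K)) :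
    Measurable fun x : Fin K → S => x ∘ σ := by
  unfold Function.comp
  fun_prop

lemma lintegral_comp_perm_withDensity {γ : Measure S} [SigmaFinite γ] (hwm : Measurable w)
    {f : (Fin K → S) → ℝ≥0∞} (hf : Measurable f) (σ : Equiv.Perm (Fin K)) :
    ∫⁻ x, f (x ∘ σ) ∂((Measure.pi fun _ => γ).withDensity fun x => ENNReal.ofReal (w x))
      = ∫⁻ x, f x * ENNReal.ofReal (w (x ∘ ⇑σ⁻¹)) ∂(Measure.pi fun _ => γ) := by
  have hfσ : Measurable fun x => f (x ∘ σ) := hf.comp (measurable_comp_perm σ)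
  have hwσ : Measurable fun x => w (x ∘ ⇑σ⁻¹) := hwm.comp (measurable_comp_perm σ⁻¹)
  rw [lintegral_withDensity_eq_lintegral_mul _ (by fun_prop) hfσ,
    ← lintegral_pi_comp_perm σ (f := fun x => f x * ENNReal.ofReal (w (x ∘ ⇑σ⁻¹)))
      (hf.mul hwσ.ennreal_ofReal)]
  simp [Function.comp_def, mul_comm]

/-- After the coordinates are relabelled by `σ` the permutation acts on the density, and the
densities `w (x_σ)` add up to the denominator of the weight. -/
lemma sum_lintegral_symWeight_sq {γ : Measure S} [SigmaFinite γ] (hw : ∀ x, 0 ≤ w x)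
    (hwm : Measurable w) {e : (Fin K → S) → ℝ} (he : Measurable e) :
    ∑ σ : Equiv.Perm (Fin K),
        ∫⁻ x, ENNReal.ofReal ((symWeight w (x ∘ σ) * e (x ∘ σ)) ^ 2)
          ∂((Measure.pi fun _ => γ).withDensity fun x => ENNReal.ofReal (w x))
      = ∫⁻ x, ENNReal.ofReal (symWeight w x * e x ^ 2)
          ∂((Measure.pi fun _ => γ).withDensity fun x => ENNReal.ofReal (w x)) := by
  have hsm : Measurable (symWeight w) := measurable_symWeight hwm
  have hf : Measurable fun x => ENNReal.ofReal ((symWeight w x * e x) ^ 2) := by fun_prop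
  have hfw : ∀ σ : Equiv.Perm (Fin K), Measurable fun x =>
      ENNReal.ofReal ((symWeight w x * e x) ^ 2) * ENNReal.ofReal (w (x ∘ ⇑σ⁻¹)) := fun σ =>
    hf.mul (hwm.comp (measurable_comp_perm σ⁻¹)).ennreal_ofReal
  simp only [lintegral_comp_perm_withDensity hwm hf]
  rw [← lintegral_finsetSum _ fun σ _ => hfw σ,
    lintegral_withDensity_eq_lintegral_mul _ (by fun_prop) (by fun_prop)]
  refine lintegral_congr fun x => ?_
  have hinv : ∑ σ : Equiv.Perm (Fin K), w (x ∘ ⇑σ⁻¹)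
      = ∑ τ : Equiv.Perm (Fin K), w (fun j => x (τ j)) :=
    Fintype.sum_equiv (Equiv.inv _) _ _ fun _ => rfl
  rw [← Finset.mul_sum, ← ENNReal.ofReal_sum_of_nonneg fun _ _ => hw _, hinv, Pi.mul_apply,
    ← ENNReal.ofReal_mul (sq_nonneg _), ← ENNReal.ofReal_mul (hw x)]
  congr 1
  linear_combination (symWeight w x * e x ^ 2) * symWeight_mul_sum_perm hw x

end SymWeight

section SecondMoment

variable {S : Type*} {K : ℕ} {α : Fin K → ℝ} {g : ℝ≥0∞ → S → ℝ≥0} {ε : ℝ}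

/-- The density `∏ j, g^{ε/α_j} (x_j)` of the sample, whose symmetrization is `rhoTilde`. -/
def densWeight (g : ℝ≥0∞ → S → ℝ≥0) (α : Fin K → ℝ) (ε : ℝ) (x : Fin K → S) : ℝ :=
  ∏ j, (g (temp ε (α j)) (x j) : ℝ)

lemma densWeight_nonneg (g : ℝ≥0∞ → S → ℝ≥0) (α : Fin K → ℝ) (ε : ℝ) (x : Fin K → S) :
    0 ≤ densWeight g α ε x :=
  Finset.prod_nonneg fun _ _ => NNReal.coe_nonneg _

lemma rhoTilde_nonneg (g : ℝ≥0∞ → S → ℝ≥0) (α : Fin K → ℝ) (ε : ℝ) (x : Fin K → S) :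
    0 ≤ rhoTilde g α ε x :=
  symWeight_nonneg (densWeight_nonneg g α ε) x

variable [MeasurableSpace S] {γ : Measure S} {μ : ℝ≥0∞ → Measure S} {Fε : ℝ → S → ℝ}

/-- The probability measures `μ^{ε/α_j}` of the components of the sample have the densities
`g^{ε/α_j}` with respect to `γ`. -/
structure HasDensities (γ : Measure S) (μ : ℝ≥0∞ → Measure S) (g : ℝ≥0∞ → S → ℝ≥0)
    (α : Fin K → ℝ) (ε : ℝ) : Prop where
  isProbabilityMeasure : ∀ j, IsProbabilityMeasure (μ (temp ε (α j)))
  measurable : ∀ j, Measurable (g (temp ε (α j)))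
  eq_withDensity : ∀ j, μ (temp ε (α j)) = γ.withDensity fun x => (g (temp ε (α j)) x : ℝ≥0∞)

/-- The law of the sample `X^ε`. -/
def sampleLaw (μ : ℝ≥0∞ → Measure S) (α : Fin K → ℝ) (ε : ℝ) : Measure (Fin K → S) :=
  Measure.pi fun j => μ (temp ε (α j))

lemma HasDensities.measurable_densWeight (h : HasDensities γ μ g α ε) :
    Measurable (densWeight g α ε) := by
  have := h.measurable
  unfold densWeight
  fun_prop

lemma HasDensities.measurable_rhoTilde (h : HasDensities γ μ g α ε) :
    Measurable (rhoTilde g α ε) :=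
  measurable_symWeight h.measurable_densWeight

lemma HasDensities.sampleLaw_eq [SigmaFinite γ] (h : HasDensities γ μ g α ε) :
    sampleLaw μ α ε
      = (Measure.pi fun _ => γ).withDensity fun x => ENNReal.ofReal (densWeight g α ε x) := by
  have := h.isProbabilityMeasure
  have hfin : ∀ j, SigmaFinite (γ.withDensity fun x => (g (temp ε (α j)) x : ℝ≥0∞)) := fun j => by
    rw [← h.eq_withDensity j]; infer_instance
  simp only [sampleLaw, h.eq_withDensity,
    pi_withDensity fun j => (h.measurable j).coe_nnreal_ennreal, densWeight,
    ENNReal.ofReal_prod_of_nonneg fun _ _ => NNReal.coe_nonneg _,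
    ENNReal.ofReal_coe_nnreal]

variable [NeZero K]

/-- The first moment `E (ρ̃^ε (X^ε; α) e ^ (-2 F^ε (X_1^ε) / ε))`, to which the second moment of
the estimator is comparable. -/
def weightedMoment (μ : ℝ≥0∞ → Measure S) (g : ℝ≥0∞ → S → ℝ≥0)
    (Fε : ℝ → S → ℝ) (α : Fin K → ℝ) (ε : ℝ) : ℝ≥0∞ :=
  ∫⁻ x, ENNReal.ofReal (rhoTilde g α ε x) * expDecay (2 * Fε ε (x 0)) ε ∂(sampleLaw μ α ε)

lemma weightedMoment_eq_sum [SigmaFinite γ] (h : HasDensities γ μ g α ε)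
    (hF : Measurable (Fε ε)) :
    weightedMoment μ g Fε α ε = ∑ σ : Equiv.Perm (Fin K), ∫⁻ x, ENNReal.ofReal
      ((rhoTilde g α ε (x ∘ σ) * Real.exp (-(1 / ε) * Fε ε (x (σ 0)))) ^ 2)
      ∂(sampleLaw μ α ε) := by
  have hsym := sum_lintegral_symWeight_sq (γ := γ) (densWeight_nonneg g α ε)
    h.measurable_densWeight (e := fun x => Real.exp (-(1 / ε) * Fε ε (x 0))) (by fun_prop)
  rw [← h.sampleLaw_eq] at hsym
  refine .trans (lintegral_congr fun x => ?_) hsym.symm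
  rw [expDecay, ← ENNReal.ofReal_mul (rhoTilde_nonneg g α ε x), ← Real.exp_nat_mul]
  congr 3
  push_cast
  ring

lemma measurable_sq_rhoTilde_comp_perm (h : HasDensities γ μ g α ε) (hF : Measurable (Fε ε))
    (σ : Equiv.Perm (Fin K)) :
    Measurable fun x : Fin K → S => ENNReal.ofReal
      ((rhoTilde g α ε (x ∘ σ) * Real.exp (-(1 / ε) * Fε ε (x (σ 0)))) ^ 2) := by
  have : Measurable fun x : Fin K → S => rhoTilde g α ε (x ∘ σ) :=
    h.measurable_rhoTilde.comp (measurable_comp_perm σ)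
  fun_prop

lemma weightedMoment_le_secondMoment [SigmaFinite γ] (h : HasDensities γ μ g α ε)
    (hF : Measurable (Fε ε)) : weightedMoment μ g Fε α ε ≤ secondMoment μ g Fε α ε := by
  rw [weightedMoment_eq_sum h hF,
    ← lintegral_finsetSum _ fun σ _ => measurable_sq_rhoTilde_comp_perm h hF σ]
  refine lintegral_mono fun x => ?_
  rw [← ENNReal.ofReal_sum_of_nonneg fun _ _ => sq_nonneg _]
  exact ENNReal.ofReal_le_ofReal (Finset.sum_sq_le_sq_sum_of_nonneg fun σ _ =>
    mul_nonneg (rhoTilde_nonneg _ _ _ _) (Real.exp_nonneg _))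

lemma secondMoment_le_card_mul_weightedMoment [SigmaFinite γ] (h : HasDensities γ μ g α ε)
    (hF : Measurable (Fε ε)) :
    secondMoment μ g Fε α ε
      ≤ Fintype.card (Equiv.Perm (Fin K)) * weightedMoment μ g Fε α ε := by
  rw [weightedMoment_eq_sum h hF,
    ← lintegral_finsetSum _ fun σ _ => measurable_sq_rhoTilde_comp_perm h hF σ,
    ← lintegral_const_mul' _ _ (ENNReal.natCast_ne_top _)]
  refine lintegral_mono fun x => ?_
  rw [← ENNReal.ofReal_sum_of_nonneg fun _ _ => sq_nonneg _, ← ENNReal.ofReal_natCast,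
    ← ENNReal.ofReal_mul (Nat.cast_nonneg _)]
  exact ENNReal.ofReal_le_ofReal sq_sum_le_card_mul_sum_sq

end SecondMoment

section LocalComparison

variable {S : Type*} {K : ℕ} {I : S → ℝ≥0∞} {α : Fin K → ℝ} {ε : ℝ}

/-- The weight `e ^ (-(1/ε) ∑ j, α_j I (x_j))`, whose symmetrization is `rho`. -/
def expWeight (I : S → ℝ≥0∞) (α : Fin K → ℝ) (ε : ℝ) (x : Fin K → S) : ℝ :=
  expNeg (∑ j, ENNReal.ofReal (α j / ε) * I (x j))

lemma expWeight_nonneg (I : S → ℝ≥0∞) (α : Fin K → ℝ) (ε : ℝ) (x : Fin K → S) :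
    0 ≤ expWeight I α ε x := by
  unfold expWeight expNeg
  split_ifs <;> positivity

lemma rho_nonneg (I : S → ℝ≥0∞) (α : Fin K → ℝ) (ε : ℝ) (x : Fin K → S) : 0 ≤ rho I α ε x :=
  symWeight_nonneg (expWeight_nonneg I α ε) x

lemma expWeight_ne_zero_iff (hε : 0 < ε) {x : Fin K → S} :
    expWeight I α ε x ≠ 0 ↔ ∀ j, 0 < α j → I (x j) ≠ ∞ := by
  have h : expWeight I α ε x ≠ 0 ↔ ∑ j, ENNReal.ofReal (α j / ε) * I (x j) ≠ ∞ := by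
    unfold expWeight expNeg
    split_ifs with h <;> simp [h]
  have hpos : ∀ j, α j / ε ≤ 0 ↔ α j ≤ 0 := fun j => by simp [div_le_iff₀ hε]
  simp [h, ENNReal.sum_eq_top, ENNReal.mul_eq_top, hpos]

lemma expWeight_eq (hε : 0 < ε) (hα : ∀ j, 0 ≤ α j) {x : Fin K → S}
    (hx : ∀ j, 0 < α j → I (x j) ≠ ∞) :
    expWeight I α ε x = Real.exp (-(∑ j, α j * (I (x j)).toReal) / ε) := by
  have h : ∑ j, ENNReal.ofReal (α j / ε) * I (x j) ≠ ∞ := fun h =>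
    (expWeight_ne_zero_iff hε).2 hx (if_pos h)
  rw [expWeight, expNeg, if_neg h, ENNReal.toReal_sum fun j hj => ENNReal.sum_ne_top.1 h j hj,
    neg_div, Finset.sum_div]
  simp only [ENNReal.toReal_mul, ENNReal.toReal_ofReal (div_nonneg (hα _) hε.le),
    div_mul_eq_mul_div]

lemma expWeight_le (hε : 0 < ε) (hα : ∀ j, 0 ≤ α j) {x : Fin K → S} {c : Fin K → ℝ}
    (hc : ∀ j, I (x j) ≠ ∞ → c j ≤ (I (x j)).toReal) :
    expWeight I α ε x ≤ Real.exp (-(∑ j, α j * c j) / ε) := by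
  by_cases h : expWeight I α ε x = 0
  · exact h.trans_le (Real.exp_nonneg _)
  · have hx := (expWeight_ne_zero_iff hε).1 h
    rw [expWeight_eq hε hα hx]
    gcongr Real.exp (-(∑ j, ?_) / ε) with j
    rcases (hα j).eq_or_lt with hj | hj
    · simp [← hj]
    · exact mul_le_mul_of_nonneg_left (hc j (hx j hj)) hj.le

lemma le_expWeight (hε : 0 < ε) (hα : ∀ j, 0 ≤ α j) {x : Fin K → S} {c : Fin K → ℝ}
    (hc : ∀ j, 0 < α j → I (x j) ≠ ∞ ∧ (I (x j)).toReal ≤ c j) :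
    Real.exp (-(∑ j, α j * c j) / ε) ≤ expWeight I α ε x := by
  rw [expWeight_eq hε hα fun j hj => (hc j hj).1]
  gcongr Real.exp (-(∑ j, ?_) / ε) with j
  rcases (hα j).eq_or_lt with hj | hj
  · simp [← hj]
  · exact mul_le_mul_of_nonneg_left (hc j hj).2 hj.le

/-- The numbers `a` and `b` agree up to the factor `c`. For nonnegative numbers this entails that
they vanish together. -/
def WithinFactor (c a b : ℝ) : Prop := a ≤ c * b ∧ b ≤ c * a

lemma WithinFactor.eq_zero_iff {a b c : ℝ} (h : WithinFactor c a b) (ha : 0 ≤ a) (hb : 0 ≤ b) :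
    a = 0 ↔ b = 0 :=
  ⟨fun h0 => le_antisymm (by simpa [h0] using h.2) hb,
    fun h0 => le_antisymm (by simpa [h0] using h.1) ha⟩

lemma withinFactor_exp_of_abs_mul_log_div_lt {a b δ : ℝ} (hε : 0 < ε) (ha : 0 ≤ a) (hb : 0 ≤ b)
    (h0 : a = 0 ↔ b = 0) (h : |ε * Real.log (a / b)| < δ) :
    WithinFactor (Real.exp (δ / ε)) a b := by
  rcases hb.eq_or_lt with hb0 | hb
  · simp [WithinFactor, ← hb0, h0.2 hb0.symm]
  have ha : 0 < a := ha.lt_of_ne' fun h => hb.ne' (h0.1 h)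
  rw [abs_mul, abs_of_pos hε, mul_comm, ← lt_div_iff₀ hε, abs_lt, Real.log_div ha.ne' hb.ne'] at h
  constructor
  · rw [← Real.log_le_log_iff ha (by positivity),
      Real.log_mul (Real.exp_pos _).ne' hb.ne', Real.log_exp]
    linarith
  · rw [← Real.log_le_log_iff hb (by positivity),
      Real.log_mul (Real.exp_pos _).ne' ha.ne', Real.log_exp]
    linarith

variable {g : ℝ≥0∞ → S → ℝ≥0} {x x' : Fin K → S} {c : ℝ}

lemma densWeight_eq_zero_iff (h : WithinFactor c (rhoTilde g α ε x) (rho I α ε x)) :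
    densWeight g α ε x = 0 ↔ expWeight I α ε x = 0 := by
  rw [← symWeight_eq_zero_iff (densWeight_nonneg g α ε),
    ← symWeight_eq_zero_iff (expWeight_nonneg I α ε)]
  exact h.eq_zero_iff (rhoTilde_nonneg g α ε x) (rho_nonneg I α ε x)

/-- The densities at the points fixed by `τ` cancel. -/
lemma densWeight_mul_comp_perm {τ : Equiv.Perm (Fin K)} (h : ∀ j, τ j ≠ j → x' j = x j) :
    densWeight g α ε x * densWeight g α ε (x' ∘ τ)
      = densWeight g α ε x' * densWeight g α ε (x ∘ τ) := by
  simp only [densWeight, ← Finset.prod_mul_distrib]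
  refine Finset.prod_congr rfl fun j _ => ?_
  by_cases hj : τ j = j
  · simp [hj, mul_comm]
  · simp [h j hj, h (τ j) fun hτ => hj (τ.injective hτ)]

lemma rhoTilde_mul_rhoTilde_comp_perm_le {τ : Equiv.Perm (Fin K)} (hx : densWeight g α ε x ≠ 0)
    (hx' : densWeight g α ε x' ≠ 0) (h : ∀ j, τ j ≠ j → x' j = x j) :
    rhoTilde g α ε x * rhoTilde g α ε (x' ∘ τ) ≤ rhoTilde g α ε x' := by
  refine (mul_symWeight_comp_perm_le_iff (densWeight_nonneg g α ε) hx' τ _).2 ?_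
  refine le_of_mul_le_mul_left ?_ ((densWeight_nonneg g α ε x).lt_of_ne' hx)
  calc densWeight g α ε x * (rhoTilde g α ε x * densWeight g α ε (x' ∘ τ))
      = densWeight g α ε x' * (rhoTilde g α ε x * densWeight g α ε (x ∘ τ)) := by
        linear_combination rhoTilde g α ε x * densWeight_mul_comp_perm h
    _ ≤ densWeight g α ε x' * densWeight g α ε x :=
        mul_le_mul_of_nonneg_left (symWeight_mul_comp_perm_le (densWeight_nonneg g α ε) x τ)
          (densWeight_nonneg g α ε x')
    _ = densWeight g α ε x * densWeight g α ε x' := mul_comm _ _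

lemma rhoTilde_mul_expWeight_comp_perm_le (hc : 0 < c) {τ : Equiv.Perm (Fin K)}
    (hx : densWeight g α ε x ≠ 0) (hx' : densWeight g α ε x' ≠ 0)
    (h : ∀ j, τ j ≠ j → x' j = x j)
    (hρ : WithinFactor c (rhoTilde g α ε x') (rho I α ε x'))
    (hρτ : WithinFactor c (rhoTilde g α ε (x' ∘ τ)) (rho I α ε (x' ∘ τ))) :
    rhoTilde g α ε x * expWeight I α ε (x' ∘ τ) ≤ c ^ 2 * expWeight I α ε x' := by
  have hrho : rhoTilde g α ε x * rho I α ε (x' ∘ τ) ≤ c ^ 2 * rho I α ε x' :=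
    calc rhoTilde g α ε x * rho I α ε (x' ∘ τ)
        ≤ rhoTilde g α ε x * (c * rhoTilde g α ε (x' ∘ τ)) :=
          mul_le_mul_of_nonneg_left hρτ.2 (rhoTilde_nonneg g α ε x)
      _ = c * (rhoTilde g α ε x * rhoTilde g α ε (x' ∘ τ)) := by ring
      _ ≤ c * (c * rho I α ε x') := by
          exact mul_le_mul_of_nonneg_left
            ((rhoTilde_mul_rhoTilde_comp_perm_le hx hx' h).trans hρ.1) hc.le
      _ = c ^ 2 * rho I α ε x' := by ring
  have hexp : expWeight I α ε x' ≠ 0 := fun h0 => hx' ((densWeight_eq_zero_iff hρ).2 h0)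
  rw [← div_le_iff₀' (by positivity), mul_div_right_comm] at hrho ⊢
  exact (mul_symWeight_comp_perm_le_iff (expWeight_nonneg I α ε) hexp τ _).1 hrho

lemma LogRatioTendstoZero.eventually_withinFactor [TopologicalSpace S] [FirstCountableTopology S]
    {δ : ℝ} (hρ : LogRatioTendstoZero I g α) (hδ : 0 < δ)
    (y : Fin K → S) :
    ∀ᶠ p in 𝓝[>] (0 : ℝ) ×ˢ 𝓝 y,
      WithinFactor (Real.exp (δ / p.1)) (rhoTilde g α p.1 p.2) (rho I α p.1 p.2) := by
  refine eventually_prod_nhds_of_forall_isCompact (P := fun ε x =>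
    WithinFactor (Real.exp (δ / ε)) (rhoTilde g α ε x) (rho I α ε x)) (fun C hC => ?_) y
  filter_upwards [hρ C hC δ hδ, self_mem_nhdsWithin] with ε h hε x hx
  exact withinFactor_exp_of_abs_mul_log_div_lt hε (rhoTilde_nonneg g α ε x) (rho_nonneg I α ε x)
    (h x hx).1 (h x hx).2

end LocalComparison

section ControlledBox

variable {S : Type*} {K : ℕ} [NeZero K] {I : S → ℝ≥0∞} {F : S → ℝ} {Fε : ℝ → S → ℝ}
  {g : ℝ≥0∞ → S → ℝ≥0} {α : Fin K → ℝ} {δ ε : ℝ} {y : Fin K → S} {N : Fin K → Set S}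

/-- On the box `∏ j, N j` around `y` the rates, the functions `F^ε` and, on the scale `ε`, the
logarithms of the quotients `ρ̃^ε / ρ^ε` vary by at most `δ`. -/
structure IsControlledBox (I : S → ℝ≥0∞) (F : S → ℝ) (Fε : ℝ → S → ℝ) (g : ℝ≥0∞ → S → ℝ≥0)
    (α : Fin K → ℝ) (δ ε : ℝ) (y : Fin K → S) (N : Fin K → Set S) : Prop where
  abs_rate_sub_le : ∀ j, ∀ z ∈ N j, I z ≠ ∞ → |(I z).toReal - (I (y j)).toReal| ≤ δ
  abs_sub_le : ∀ z ∈ Set.univ.pi N, |Fε ε (z 0) - F (y 0)| ≤ δ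
  withinFactor : ∀ z ∈ Set.univ.pi N, ∀ σ : Equiv.Perm (Fin K),
    WithinFactor (Real.exp (δ / ε)) (rhoTilde g α ε (z ∘ σ)) (rho I α ε (z ∘ σ))

section Topology

variable [TopologicalSpace S] [FirstCountableTopology S]

lemma eventually_abs_sub_le (hF : Continuous F)
    (hFε : ∀ C : Set S, IsCompact C → TendstoUniformlyOn Fε F (𝓝[>] 0) C) (hδ : 0 < δ) (y : S) :
    ∀ᶠ p in 𝓝[>] (0 : ℝ) ×ˢ 𝓝 y, |Fε p.1 p.2 - F y| ≤ δ := by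
  have hunif := eventually_prod_nhds_of_forall_isCompact (P := fun ε x => |F x - Fε ε x| < δ / 2)
    (fun C hC => Metric.tendstoUniformlyOn_iff.1 (hFε C hC) _ (half_pos hδ)) y
  have hcont : ∀ᶠ x in 𝓝 y, |F x - F y| < δ / 2 :=
    hF.continuousAt.eventually (Metric.ball_mem_nhds (F y) (half_pos hδ))
  filter_upwards [hunif, hcont.prod_inr _] with p h1 h2
  rw [abs_lt] at h1 h2
  exact abs_le.2 ⟨by linarith, by linarith⟩

lemma exists_isControlledBox [RegularSpace S] (hI : ContinuousOn I {x | I x ≠ ∞})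
    (hF : Continuous F) (hFε : ∀ C : Set S, IsCompact C → TendstoUniformlyOn Fε F (𝓝[>] 0) C)
    (hρ : LogRatioTendstoZero I g α) (hδ : 0 < δ) (hy : ∀ j, I (y j) ≠ ∞) :
    ∃ N : Fin K → Set S, (∀ j, IsClosed (N j)) ∧ (∀ j, N j ∈ 𝓝 (y j)) ∧
      ∀ᶠ ε in 𝓝[>] (0 : ℝ), IsControlledBox I F Fε g α δ ε y N := by
  have hF0 : ∀ᶠ p in 𝓝[>] (0 : ℝ) ×ˢ 𝓝 y, |Fε p.1 (p.2 0) - F (y 0)| ≤ δ :=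
    (tendsto_id.prodMap ((continuous_apply 0).tendsto y)).eventually
      (eventually_abs_sub_le hF hFε hδ (y 0))
  have hρσ : ∀ᶠ p in 𝓝[>] (0 : ℝ) ×ˢ 𝓝 y, ∀ σ : Equiv.Perm (Fin K),
      WithinFactor (Real.exp (δ / p.1)) (rhoTilde g α p.1 (p.2 ∘ σ)) (rho I α p.1 (p.2 ∘ σ)) :=
    eventually_all.2 fun σ =>
      (tendsto_id.prodMap ((Pi.continuous_precomp σ).tendsto y)).eventually
        (hρ.eventually_withinFactor hδ (y ∘ σ))
  choose s hs hsI using fun j => exists_nhds_abs_toReal_sub_le hI (hy j) hδ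
  obtain ⟨N, hNc, hN, hNs, hev⟩ := exists_isClosed_pi_forall_of_eventually_prod_nhds
    (P := fun ε z => |Fε ε (z 0) - F (y 0)| ≤ δ ∧ ∀ σ : Equiv.Perm (Fin K),
      WithinFactor (Real.exp (δ / ε)) (rhoTilde g α ε (z ∘ σ)) (rho I α ε (z ∘ σ)))
    (hF0.and hρσ) hs
  exact ⟨N, hNc, hN, hev.mono fun ε h => ⟨fun j z hz => hsI j z (hNs j hz),
    fun z hz => (h z hz).1, fun z hz => (h z hz).2⟩⟩

end Topology

lemma IsControlledBox.expWeight_comp_perm_le (h : IsControlledBox I F Fε g α δ ε y N) (hε : 0 < ε)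
    (hα : ∀ j, 0 ≤ α j) {z : Fin K → S} (hz : z ∈ Set.univ.pi N) (σ : Equiv.Perm (Fin K)) :
    expWeight I α ε (z ∘ σ)
      ≤ Real.exp (-(∑ j, α j * (I (y (σ j))).toReal - (∑ j, α j) * δ) / ε) := by
  refine (expWeight_le hε hα (c := fun j => (I (y (σ j))).toReal - δ) fun j hj => ?_).trans_eq ?_
  · have := (abs_le.1 (h.abs_rate_sub_le (σ j) (z (σ j)) (hz _ trivial) hj)).1
    simp only [Function.comp_apply]
    linarith
  · simp only [mul_sub, Finset.sum_sub_distrib, ← Finset.sum_mul]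

lemma IsControlledBox.le_expWeight_comp_perm (h : IsControlledBox I F Fε g α δ ε y N) (hε : 0 < ε)
    (hα : ∀ j, 0 ≤ α j) {z : Fin K → S} (hz : z ∈ Set.univ.pi N) (σ : Equiv.Perm (Fin K))
    (hzI : ∀ j, 0 < α j → I (z (σ j)) ≠ ∞) :
    Real.exp (-(∑ j, α j * (I (y (σ j))).toReal + (∑ j, α j) * δ) / ε)
      ≤ expWeight I α ε (z ∘ σ) := by
  refine le_of_eq_of_le ?_ (le_expWeight hε hα (c := fun j => (I (y (σ j))).toReal + δ)
    fun j hj => ⟨hzI j hj, ?_⟩)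
  · simp only [mul_add, Finset.sum_add_distrib, ← Finset.sum_mul]
  · have := (abs_le.1 (h.abs_rate_sub_le (σ j) (z (σ j)) (hz _ trivial) (hzI j hj))).2
    simp only [Function.comp_apply]
    linarith

lemma IsControlledBox.densWeight_ne_zero_iff (h : IsControlledBox I F Fε g α δ ε y N)
    (hε : 0 < ε) {z : Fin K → S} (hz : z ∈ Set.univ.pi N) :
    densWeight g α ε z ≠ 0 ↔ ∀ j, 0 < α j → I (z j) ≠ ∞ := by
  rw [← expWeight_ne_zero_iff hε]
  exact not_congr (densWeight_eq_zero_iff (h.withinFactor z hz 1))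

end ControlledBox

section BoxEstimate

variable {S : Type*} {K : ℕ} {I : S → ℝ≥0∞} {F : S → ℝ} {Fε : ℝ → S → ℝ}
  {g : ℝ≥0∞ → S → ℝ≥0} {α : Fin K → ℝ} {δ ε : ℝ} {y : Fin K → S} {N : Fin K → Set S}

lemma densWeight_ne_zero_iff_forall {x : Fin K → S} :
    densWeight g α ε x ≠ 0 ↔ ∀ j, g (temp ε (α j)) (x j) ≠ 0 := by
  simp [densWeight, Finset.prod_ne_zero_iff]

/-- The coordinates `j` with `α j = 0` do not have to lie in the box: `τ` fixes them, so they may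
be replaced by those of `y`. -/
lemma IsControlledBox.rhoTilde_le [NeZero K] (h : IsControlledBox I F Fε g α δ ε y N) (hε : 0 < ε)
    (hα : ∀ j, 0 ≤ α j) (hy : ∀ j, I (y j) ≠ ∞) (hyN : ∀ j, y j ∈ N j) {x : Fin K → S}
    (hxN : x ∈ {j | 0 < α j}.pi N) (hx : densWeight g α ε x ≠ 0) {τ : Equiv.Perm (Fin K)}
    (hτ : ∀ j, α j = 0 → τ j = j) :
    rhoTilde g α ε x ≤ Real.exp (-(∑ j, α j * (I (y j)).toReal - ∑ j, α j * (I (y (τ j))).toReal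
      - (2 + 2 * ∑ j, α j) * δ) / ε) := by
  set x' : Fin K → S := fun j => if α j = 0 then y j else x j with hx'_def
  have hx'N : x' ∈ Set.univ.pi N := fun j _ => by
    simp only [hx'_def]
    split_ifs with hj
    exacts [hyN j, hxN j ((hα j).lt_of_ne' hj)]
  have hx' : densWeight g α ε x' ≠ 0 := by
    have hyd := (h.densWeight_ne_zero_iff hε fun j _ => hyN j).2 fun j _ => hy j
    rw [densWeight_ne_zero_iff_forall] at hx hyd ⊢
    intro j
    simp only [hx'_def]
    split_ifs
    exacts [hyd j, hx j]
  have hmoved : ∀ j, τ j ≠ j → x' j = x j := fun j hj => if_neg (mt (hτ j) hj)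
  have hpos : ∀ j, 0 < α j → 0 < α (τ j) := fun j hj =>
    (hα _).lt_of_ne' fun h0 => hj.ne' (by rwa [τ.injective (hτ _ h0)] at h0)
  have hlow := h.le_expWeight_comp_perm hε hα hx'N τ fun j hj =>
    (h.densWeight_ne_zero_iff hε hx'N).1 hx' _ (hpos j hj)
  have hup := h.expWeight_comp_perm_le hε hα hx'N 1
  have hmul := rhoTilde_mul_expWeight_comp_perm_le (Real.exp_pos (δ / ε)) hx hx' hmoved
    (h.withinFactor x' hx'N 1) (h.withinFactor x' hx'N τ)
  refine le_of_mul_le_mul_right ?_ (Real.exp_pos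
    (-(∑ j, α j * (I (y (τ j))).toReal + (∑ j, α j) * δ) / ε))
  calc rhoTilde g α ε x * Real.exp (-(∑ j, α j * (I (y (τ j))).toReal + (∑ j, α j) * δ) / ε)
      ≤ rhoTilde g α ε x * expWeight I α ε (x' ∘ τ) :=
        mul_le_mul_of_nonneg_left hlow (rhoTilde_nonneg g α ε x)
    _ ≤ Real.exp (δ / ε) ^ 2 * expWeight I α ε x' := hmul
    _ ≤ Real.exp (δ / ε) ^ 2
          * Real.exp (-(∑ j, α j * (I (y j)).toReal - (∑ j, α j) * δ) / ε) :=
        mul_le_mul_of_nonneg_left hup (sq_nonneg _)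
    _ = _ := by
        rw [← Real.exp_nat_mul, ← Real.exp_add, ← Real.exp_add]
        push_cast
        ring_nf

variable [MeasurableSpace S] {γ : Measure S} {μ : ℝ≥0∞ → Measure S}

lemma HasDensities.ae_densWeight_ne_zero [SigmaFinite γ] (h : HasDensities γ μ g α ε) :
    ∀ᵐ x ∂(sampleLaw μ α ε), densWeight g α ε x ≠ 0 := by
  rw [h.sampleLaw_eq, ae_withDensity_iff h.measurable_densWeight.ennreal_ofReal]
  exact Eventually.of_forall fun x hx h0 => hx (by simp [h0])

lemma HasDensities.sampleLaw_pi (h : HasDensities γ μ g α ε) (s : Set (Fin K))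
    [DecidablePred (· ∈ s)] (N : Fin K → Set S) :
    sampleLaw μ α ε (s.pi N) = ∏ j, if j ∈ s then μ (temp ε (α j)) (N j) else 1 := by
  have := h.isProbabilityMeasure
  rw [← Set.univ_pi_ite, sampleLaw, Measure.pi_pi]
  exact Finset.prod_congr rfl fun j _ => by split_ifs <;> simp

lemma HasDensities.sampleLaw_eval_preimage (h : HasDensities γ μ g α ε) (j : Fin K) {C : Set S}
    (hC : MeasurableSet C) : sampleLaw μ α ε (Function.eval j ⁻¹' C) = μ (temp ε (α j)) C := by
  have := h.isProbabilityMeasure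
  exact (measurePreserving_eval (fun j => μ (temp ε (α j))) j).measure_preimage
    hC.nullMeasurableSet

lemma HasDensities.measure_ne_zero_of_density_ne_zero (h : HasDensities γ μ g α ε) {i j : Fin K}
    {U : Set S} (hg : ∀ z ∈ U, g (temp ε (α j)) z ≠ 0) (hU : μ (temp ε (α i)) U ≠ 0) :
    μ (temp ε (α j)) U ≠ 0 := by
  contrapose! hU
  rw [h.eq_withDensity j,
    withDensity_apply_eq_zero' (h.measurable j).coe_nnreal_ennreal.aemeasurable,
    Set.inter_eq_self_of_subset_right fun z hz => by simpa using hg z hz] at hU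
  rw [h.eq_withDensity i]
  exact withDensity_absolutelyContinuous _ _ hU

lemma eventually_sampleLaw_pi_le [TopologicalSpace S]
    (hd : ∀ ε, 0 < ε → HasDensities γ μ g α ε)
    (hLDP : SatisfiesLDP (fun ε => μ (ENNReal.ofReal ε)) I) (hα : ∀ j, 0 ≤ α j)
    (hN : ∀ j, IsClosed (N j)) {a b : Fin K → ℝ}
    (ha : ∀ j, ∀ x ∈ N j, I x ≠ ∞ → a j ≤ (I x).toReal) (hb : ∀ j, b j < a j) :
    ∀ᶠ ε in 𝓝[>] (0 : ℝ), sampleLaw μ α ε ({j | 0 < α j}.pi N) ≤ expDecay (∑ j, α j * b j) ε := by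
  classical
  have hμ : ∀ᶠ ε in 𝓝[>] (0 : ℝ), ∀ j, 0 < α j →
      μ (temp ε (α j)) (N j) ≤ expDecay (α j * b j) ε :=
    eventually_all.2 fun j => eventually_imp_distrib_left.2 fun hj =>
      eventually_measure_temp_le hLDP hj (hN j) (ha j) (hb j)
  filter_upwards [hμ, self_mem_nhdsWithin] with ε hμ hε
  rw [(hd ε hε).sampleLaw_pi, expDecay_sum]
  refine Finset.prod_le_prod' fun j _ => ?_
  rcases (hα j).eq_or_lt with hj | hj
  · simp [← hj, expDecay]
  · simpa [hj] using hμ j hj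

end BoxEstimate

section WeightedLaw

variable {S : Type*} {K : ℕ} [NeZero K] [MeasurableSpace S] {γ : Measure S}
  {μ : ℝ≥0∞ → Measure S} {g : ℝ≥0∞ → S → ℝ≥0} {Fε : ℝ → S → ℝ} {α : Fin K → ℝ} {ε : ℝ}
  {s : Set (Fin K → S)} {p q : ℝ}

/-- The measure with total mass `weightedMoment`; it serves to localize the moment. -/
def weightedLaw (μ : ℝ≥0∞ → Measure S) (g : ℝ≥0∞ → S → ℝ≥0) (Fε : ℝ → S → ℝ)
    (α : Fin K → ℝ) (ε : ℝ) : Measure (Fin K → S) :=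
  (sampleLaw μ α ε).withDensity fun x =>
    ENNReal.ofReal (rhoTilde g α ε x) * expDecay (2 * Fε ε (x 0)) ε

lemma weightedLaw_univ : weightedLaw μ g Fε α ε Set.univ = weightedMoment μ g Fε α ε := by
  rw [weightedLaw, withDensity_apply _ .univ, Measure.restrict_univ, weightedMoment]

lemma weightedLaw_le_expDecay (hs : MeasurableSet s)
    (h : ∀ᵐ x ∂(sampleLaw μ α ε), x ∈ s →
      ENNReal.ofReal (rhoTilde g α ε x) * expDecay (2 * Fε ε (x 0)) ε ≤ expDecay p ε)
    (hq : sampleLaw μ α ε s ≤ expDecay q ε) : weightedLaw μ g Fε α ε s ≤ expDecay (p + q) ε := by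
  rw [weightedLaw, withDensity_apply _ hs, expDecay_add]
  calc _ ≤ ∫⁻ _ in s, expDecay p ε ∂(sampleLaw μ α ε) := setLIntegral_mono_ae' hs h
    _ = expDecay p ε * sampleLaw μ α ε s := setLIntegral_const _ _
    _ ≤ expDecay p ε * expDecay q ε := by gcongr

lemma expDecay_le_mul_weightedLaw {c : ℝ≥0∞} (hc : c ≠ ∞) (hs : MeasurableSet s)
    (h : ∀ᵐ x ∂(sampleLaw μ α ε), x ∈ s →
      expDecay p ε ≤ c * (ENNReal.ofReal (rhoTilde g α ε x) * expDecay (2 * Fε ε (x 0)) ε))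
    (hq : expDecay q ε ≤ sampleLaw μ α ε s) :
    expDecay (p + q) ε ≤ c * weightedLaw μ g Fε α ε s := by
  rw [weightedLaw, withDensity_apply _ hs, expDecay_add, ← lintegral_const_mul' _ _ hc]
  calc expDecay p ε * expDecay q ε ≤ expDecay p ε * sampleLaw μ α ε s := by gcongr
    _ = ∫⁻ _ in s, expDecay p ε ∂(sampleLaw μ α ε) := (setLIntegral_const _ _).symm
    _ ≤ _ := setLIntegral_mono_ae' hs h

lemma IsControlledBox.weightedLaw_pi_le [SigmaFinite γ] {I : S → ℝ≥0∞} {F : S → ℝ}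
    {δ : ℝ} {y : Fin K → S} {N : Fin K → Set S} (h : IsControlledBox I F Fε g α δ ε y N)
    (hd : HasDensities γ μ g α ε) (hε : 0 < ε) (hα : ∀ j, 0 ≤ α j) (hα0 : 0 < α 0)
    (hy : ∀ j, I (y j) ≠ ∞) (hyN : ∀ j, y j ∈ N j) (hN : ∀ j, MeasurableSet (N j))
    {τ : Equiv.Perm (Fin K)} (hτ : ∀ j, α j = 0 → τ j = j)
    (hq : sampleLaw μ α ε ({j | 0 < α j}.pi N) ≤ expDecay q ε) :
    weightedLaw μ g Fε α ε ({j | 0 < α j}.pi N) ≤ expDecay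
      ((∑ j, α j * (I (y j)).toReal - ∑ j, α j * (I (y (τ j))).toReal - (2 + 2 * ∑ j, α j) * δ)
        + 2 * (F (y 0) - δ) + q) ε := by
  refine weightedLaw_le_expDecay (MeasurableSet.pi (Set.to_countable _) fun j _ => hN j) ?_ hq
  filter_upwards [hd.ae_densWeight_ne_zero] with x hx hxN
  have hF : F (y 0) - δ ≤ Fε ε (x 0) := by
    have hbox : Function.update y 0 (x 0) ∈ Set.univ.pi N := fun j _ => by
      rcases eq_or_ne j 0 with rfl | hj
      · simpa using hxN 0 hα0
      · simpa [hj] using hyN j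
    have := (abs_le.1 (h.abs_sub_le _ hbox)).1
    rw [Function.update_self] at this
    linarith
  rw [expDecay_add]
  exact mul_le_mul' (ENNReal.ofReal_le_ofReal (h.rhoTilde_le hε hα hy hyN hxN hx hτ))
    (expDecay_anti hε (by linarith))

end WeightedLaw

section Upper

variable {S : Type*} [TopologicalSpace S] [MeasurableSpace S] [OpensMeasurableSpace S]
  {K : ℕ} [NeZero K] {α : Fin K → ℝ} {γ : Measure S} {μ : ℝ≥0∞ → Measure S}
  {g : ℝ≥0∞ → S → ℝ≥0} {I : S → ℝ≥0∞} {F : S → ℝ} {Fε : ℝ → S → ℝ}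

lemma eventually_weightedLaw_eval_preimage_le (hd : ∀ ε, 0 < ε → HasDensities γ μ g α ε)
    (hLDP : SatisfiesLDP (fun ε => μ (ENNReal.ofReal ε)) I) {b : ℝ}
    (hb : ∀ᶠ ε in 𝓝[>] (0 : ℝ), ∀ x, b ≤ Fε ε x) {j : Fin K} (hj : 0 < α j) {C : Set S}
    (hC : IsClosed C) {a r : ℝ} (ha : ∀ x ∈ C, I x ≠ ∞ → a ≤ (I x).toReal)
    (hr : r < α j * a + 2 * b) :
    ∀ᶠ ε in 𝓝[>] (0 : ℝ), weightedLaw μ g Fε α ε (Function.eval j ⁻¹' C) ≤ expDecay r ε := by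
  have hlt : (r - 2 * b) / α j < a := by rw [div_lt_iff₀' hj]; linarith
  filter_upwards [eventually_measure_temp_le hLDP hj hC ha hlt, hb, self_mem_nhdsWithin]
    with ε hμ hb hε
  rw [mul_div_cancel₀ _ hj.ne', ← (hd ε hε).sampleLaw_eval_preimage j hC.measurableSet] at hμ
  rw [← add_sub_cancel (2 * b) r]
  refine weightedLaw_le_expDecay (measurable_pi_apply j hC.measurableSet)
    (Eventually.of_forall fun x _ => ?_) hμ
  calc ENNReal.ofReal (rhoTilde g α ε x) * expDecay (2 * Fε ε (x 0)) ε
      ≤ 1 * expDecay (2 * b) ε := by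
        gcongr
        · exact ENNReal.ofReal_le_one.2 (symWeight_le_one (densWeight_nonneg g α ε) x)
        · exact expDecay_anti hε (by linarith [hb (x 0)])
    _ = expDecay (2 * b) ε := one_mul _

lemma exists_nhds_eventually_weightedLaw_pi_le [RegularSpace S] [FirstCountableTopology S]
    [SigmaFinite γ] (hd : ∀ ε, 0 < ε → HasDensities γ μ g α ε)
    (hLDP : SatisfiesLDP (fun ε => μ (ENNReal.ofReal ε)) I) (hI : ContinuousOn I {x | I x ≠ ∞})
    (hF : Continuous F) (hFε : ∀ C : Set S, IsCompact C → TendstoUniformlyOn Fε F (𝓝[>] 0) C)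
    (hρ : LogRatioTendstoZero I g α) (hα : ∀ j, 0 ≤ α j) (hα0 : 0 < α 0) {y : Fin K → S}
    (hy : ∀ j, I (y j) ≠ ∞) {r : ℝ} (hr : (r : EReal) < V I F α) :
    ∃ N : Fin K → Set S, (∀ j, N j ∈ 𝓝 (y j)) ∧
      ∀ᶠ ε in 𝓝[>] (0 : ℝ), weightedLaw μ g Fε α ε ({j | 0 < α j}.pi N) ≤ expDecay r ε := by
  obtain ⟨τ, w, hτ, hw, hw0, hcost⟩ := exists_perm_cost_le hα hα0
    (v := fun j => (I (y j)).toReal) fun j => ENNReal.toReal_nonneg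
  have hrw : r < cost α w + 2 * F (y 0) :=
    EReal.coe_lt_coe_iff.1 (hr.trans_le (V_le_cost_add hw (hy 0) hw0))
  set A := ∑ j, α j with hA
  have hA0 : 0 ≤ A := Finset.sum_nonneg fun j _ => hα j
  obtain ⟨δ, hδ, hrδ⟩ : ∃ δ > 0, r + (4 + 4 * A) * δ = cost α w + 2 * F (y 0) :=
    ⟨(cost α w + 2 * F (y 0) - r) / (4 + 4 * A), by have := sub_pos.2 hrw; positivity,
      by field_simp; ring⟩
  obtain ⟨N, hNc, hN, hbox⟩ := exists_isControlledBox hI hF hFε hρ hδ hy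
  refine ⟨N, hN, ?_⟩
  have hprob := eventually_sampleLaw_pi_le hd hLDP hα hNc
    (a := fun j => (I (y j)).toReal - δ) (b := fun j => (I (y j)).toReal - 2 * δ)
    (fun j x hx hIx => ?_) fun j => by linarith
  · filter_upwards [hbox, hprob, self_mem_nhdsWithin] with ε hbox hprob hε
    refine (hbox.weightedLaw_pi_le (hd ε hε) hε hα hα0 hy (fun j => mem_of_mem_nhds (hN j))
      (fun j => (hNc j).measurableSet) hτ hprob).trans (expDecay_anti hε ?_)
    simp only [mul_sub, Finset.sum_sub_distrib, ← Finset.sum_mul, ← hA]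
    linarith
  · obtain ⟨ε, hbox⟩ := hbox.exists
    linarith [(abs_le.1 (hbox.abs_rate_sub_le j x hx hIx)).1]

theorem eventually_weightedMoment_le [T3Space S] [FirstCountableTopology S]
    [SigmaFinite γ] (hd : ∀ ε, 0 < ε → HasDensities γ μ g α ε)
    (hLDP : SatisfiesLDP (fun ε => μ (ENNReal.ofReal ε)) I) (hI : ContinuousOn I {x | I x ≠ ∞})
    (hF : Continuous F) (hFε : ∀ C : Set S, IsCompact C → TendstoUniformlyOn Fε F (𝓝[>] 0) C)
    (hρ : LogRatioTendstoZero I g α) (hα : ∀ j, 0 ≤ α j) (hα0 : 0 < α 0) {x₀ : S}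
    (hx₀ : I x₀ = 0) {b : ℝ} (hb : ∀ᶠ ε in 𝓝[>] (0 : ℝ), ∀ x, b ≤ Fε ε x) {r : ℝ}
    (hr : (r : EReal) < V I F α) :
    ∀ᶠ ε in 𝓝[>] (0 : ℝ), weightedMoment μ g Fε α ε ≤ expDecay r ε := by
  obtain ⟨s, hrs, hsV⟩ := EReal.lt_iff_exists_real_btwn.1 hr
  obtain ⟨M, hM⟩ : ∃ M : ℝ≥0, ∀ j, 0 < α j → s < α j * M + 2 * b :=
    (eventually_all.2 fun j => eventually_imp_distrib_left.2 fun hj =>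
      (tendsto_atTop_add_const_right _ _
        ((NNReal.tendsto_coe_atTop.2 tendsto_id).const_mul_atTop hj)).eventually_gt_atTop s).exists
  have hlocal := fun (y : Fin K → S) (hy : y ∈ Set.univ.pi fun _ => {x | I x ≤ M}) =>
    exists_nhds_eventually_weightedLaw_pi_le hd hLDP hI hF hFε hρ hα hα0
      (fun j => ne_top_of_le_ne_top ENNReal.coe_ne_top (hy j trivial)) hsV
  choose! N hN hNε using hlocal
  obtain ⟨t, ht, U, hU, hCU, hcover⟩ := exists_finset_isOpen_cover_pi (hLDP.rate M)
    ⟨x₀, by simp [hx₀]⟩ hN {j | 0 < α j}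
  have htail : ∀ x ∈ Uᶜ, I x ≠ ∞ → (M : ℝ) ≤ (I x).toReal := fun x hx hIx =>
    (ENNReal.toReal_mono hIx (not_le.1 (mt (@hCU x) hx)).le :)
  have hUε : ∀ᶠ ε in 𝓝[>] (0 : ℝ), ∀ j, 0 < α j →
      weightedLaw μ g Fε α ε (Function.eval j ⁻¹' Uᶜ) ≤ expDecay s ε :=
    eventually_all.2 fun j => eventually_imp_distrib_left.2 fun hj =>
      eventually_weightedLaw_eval_preimage_le hd hLDP hb hj hU.isClosed_compl htail (hM j hj)
  filter_upwards [(eventually_all_finset t).2 fun y hy => hNε y (ht y hy), hUε,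
    eventually_natCast_mul_expDecay_le (t.card + K) (EReal.coe_lt_coe_iff.1 hrs)]
    with ε hNε hUε hcard
  rw [← weightedLaw_univ]
  exact (measure_univ_le_card_mul hcover hNε hUε).trans (by simpa using hcard)

end Upper

section Lower

variable {S : Type*} {K : ℕ} [NeZero K] {I : S → ℝ≥0∞} {F : S → ℝ} {Fε : ℝ → S → ℝ}
  {g : ℝ≥0∞ → S → ℝ≥0} {α : Fin K → ℝ} {δ ε : ℝ} {y : Fin K → S} {N : Fin K → Set S}

lemma IsControlledBox.le_card_mul_rhoTilde (h : IsControlledBox I F Fε g α δ ε y N) (hε : 0 < ε)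
    (hα : ∀ j, 0 ≤ α j) {z : Fin K → S} (hzN : z ∈ Set.univ.pi N)
    (hz : densWeight g α ε z ≠ 0) :
    Real.exp (-(∑ j, α j * (I (y j)).toReal - minCost α (fun j => (I (y j)).toReal)
      + (1 + 2 * ∑ j, α j) * δ) / ε)
      ≤ Fintype.card (Equiv.Perm (Fin K)) * rhoTilde g α ε z := by
  set E := Real.exp (-(minCost α (fun j => (I (y j)).toReal) - (∑ j, α j) * δ) / ε)
  have hlow := h.le_expWeight_comp_perm hε hα hzN 1 ((h.densWeight_ne_zero_iff hε hzN).1 hz)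
  have hsum : ∑ σ : Equiv.Perm (Fin K), expWeight I α ε (z ∘ σ)
      ≤ Fintype.card (Equiv.Perm (Fin K)) * E := by
    rw [← nsmul_eq_mul, ← Finset.card_univ]
    refine Finset.sum_le_card_nsmul _ _ _ fun σ _ => ?_
    refine (h.expWeight_comp_perm_le hε hα hzN σ).trans (Real.exp_le_exp.2 ?_)
    gcongr
    exact minCost_le α _ σ
  refine le_of_mul_le_mul_right ?_ (mul_pos (Real.exp_pos (δ / ε)) (Real.exp_pos _ : 0 < E))
  calc _ = Real.exp (-(∑ j, α j * (I (y j)).toReal + (∑ j, α j) * δ) / ε) := by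
        rw [← Real.exp_add, ← Real.exp_add]
        ring_nf
    _ ≤ expWeight I α ε z := hlow
    _ = rho I α ε z * ∑ σ : Equiv.Perm (Fin K), expWeight I α ε (z ∘ σ) :=
        (symWeight_mul_sum_perm (expWeight_nonneg I α ε) z).symm
    _ ≤ (Real.exp (δ / ε) * rhoTilde g α ε z) * (Fintype.card (Equiv.Perm (Fin K)) * E) :=
        mul_le_mul (h.withinFactor z hzN 1).2 hsum
          (Finset.sum_nonneg fun σ _ => expWeight_nonneg I α ε _)
          (mul_nonneg (Real.exp_nonneg _) (rhoTilde_nonneg g α ε z))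
    _ = _ := by ring

lemma IsControlledBox.density_ne_zero (h : IsControlledBox I F Fε g α δ ε y N) (hε : 0 < ε)
    (hy : ∀ j, I (y j) ≠ ∞) (hyN : ∀ j, y j ∈ N j) {j : Fin K} (hj : α j = 0) {z : S}
    (hz : z ∈ N j) : g (temp ε (α j)) z ≠ 0 := by
  have hbox : Function.update y j z ∈ Set.univ.pi N := fun i _ => by
    rcases eq_or_ne i j with rfl | hi
    · simpa using hz
    · simpa [hi] using hyN i
  have hdens := (h.densWeight_ne_zero_iff hε hbox).2 fun i hi => by
    rw [Function.update_of_ne (by rintro rfl; exact hi.ne' hj)]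
    exact hy i
  simpa using densWeight_ne_zero_iff_forall.1 hdens j

lemma IsControlledBox.ofReal_rhoTilde_mul_ge (h : IsControlledBox I F Fε g α δ ε y N)
    (hε : 0 < ε) (hα : ∀ j, 0 ≤ α j) {z : Fin K → S} (hzN : z ∈ Set.univ.pi N)
    (hz : densWeight g α ε z ≠ 0) :
    expDecay ((∑ j, α j * (I (y j)).toReal - minCost α (fun j => (I (y j)).toReal)
      + (1 + 2 * ∑ j, α j) * δ) + 2 * (F (y 0) + δ)) ε
      ≤ Fintype.card (Equiv.Perm (Fin K))
        * (ENNReal.ofReal (rhoTilde g α ε z) * expDecay (2 * Fε ε (z 0)) ε) := by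
  rw [expDecay_add, ← mul_assoc, ← ENNReal.ofReal_natCast, ← ENNReal.ofReal_mul (by positivity)]
  exact mul_le_mul' (ENNReal.ofReal_le_ofReal (h.le_card_mul_rhoTilde hε hα hzN hz))
    (expDecay_anti hε (by linarith [(abs_le.1 (h.abs_sub_le z hzN)).2]))

variable [MeasurableSpace S] {γ : Measure S} {μ : ℝ≥0∞ → Measure S} [TopologicalSpace S]

lemma eventually_le_sampleLaw_pi (hd : ∀ ε, 0 < ε → HasDensities γ μ g α ε)
    (hLDP : SatisfiesLDP (fun ε => μ (ENNReal.ofReal ε)) I) (hα : ∀ j, 0 ≤ α j) (hα0 : 0 < α 0)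
    (hδ : 0 < δ) (hy : ∀ j, I (y j) ≠ ∞) (hN : ∀ j, N j ∈ 𝓝 (y j))
    (hbox : ∀ᶠ ε in 𝓝[>] (0 : ℝ), IsControlledBox I F Fε g α δ ε y N) :
    ∀ᶠ ε in 𝓝[>] (0 : ℝ), expDecay (∑ j, (α j * (I (y j)).toReal + δ)) ε
      ≤ sampleLaw μ α ε (Set.univ.pi N) := by
  have hpos : ∀ {i j}, 0 < α i → ∀ᶠ ε in 𝓝[>] (0 : ℝ),
      expDecay (α i * (I (y j)).toReal + δ) ε ≤ μ (temp ε (α i)) (N j) := fun {i j} hi => by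
    filter_upwards [eventually_le_measure_temp hLDP hi isOpen_interior
      (mem_interior_iff_mem_nhds.2 (hN j)) (hy j)
      (lt_add_of_pos_right (I (y j)).toReal (div_pos hδ hi))] with ε hε
    rw [mul_add, mul_div_cancel₀ _ hi.ne'] at hε
    exact hε.trans (measure_mono interior_subset)
  have hzero : ∀ {j}, α j = 0 → ∀ᶠ ε in 𝓝[>] (0 : ℝ), expDecay δ ε ≤ μ (temp ε (α j)) (N j) :=
    fun {j} hj => by
      have htemp : ∀ {ε : ℝ}, 0 < ε → temp ε (α j) = ∞ := fun hε => temp_of_nonpos hε hj.le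
      obtain ⟨ε, hμε, hboxε, hε⟩ := ((hpos hα0).and (hbox.and self_mem_nhdsWithin)).exists
      have hne := (hd ε hε).measure_ne_zero_of_density_ne_zero
        (fun z hz => hboxε.density_ne_zero hε hy (fun j => mem_of_mem_nhds (hN j)) hj hz)
        ((ENNReal.ofReal_pos.2 (Real.exp_pos _)).trans_le hμε).ne'
      rw [htemp hε] at hne
      filter_upwards [eventually_expDecay_le hδ hne, self_mem_nhdsWithin] with ε' h hε'
      rwa [htemp hε']
  have hall : ∀ᶠ ε in 𝓝[>] (0 : ℝ), ∀ j,
      expDecay (α j * (I (y j)).toReal + δ) ε ≤ μ (temp ε (α j)) (N j) := by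
    refine eventually_all.2 fun j => ?_
    rcases (hα j).eq_or_lt with hj | hj
    · simpa [← hj] using hzero hj.symm
    · exact hpos hj
  filter_upwards [hall, self_mem_nhdsWithin] with ε h hε
  have := (hd ε hε).isProbabilityMeasure
  rw [expDecay_sum, sampleLaw, Measure.pi_pi]
  exact Finset.prod_le_prod' fun j _ => h j

variable [RegularSpace S] [FirstCountableTopology S] [OpensMeasurableSpace S] [SigmaFinite γ]

lemma eventually_le_weightedMoment_of_cost_lt (hd : ∀ ε, 0 < ε → HasDensities γ μ g α ε)
    (hLDP : SatisfiesLDP (fun ε => μ (ENNReal.ofReal ε)) I) (hI : ContinuousOn I {x | I x ≠ ∞})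
    (hF : Continuous F) (hFε : ∀ C : Set S, IsCompact C → TendstoUniformlyOn Fε F (𝓝[>] 0) C)
    (hρ : LogRatioTendstoZero I g α) (hα : ∀ j, 0 ≤ α j) (hα0 : 0 < α 0)
    (hy : ∀ j, I (y j) ≠ ∞) {r : ℝ}
    (hr : cost α (fun j => (I (y j)).toReal) + 2 * F (y 0) < r) :
    ∀ᶠ ε in 𝓝[>] (0 : ℝ), expDecay r ε ≤ weightedMoment μ g Fε α ε := by
  obtain ⟨s, hs, hsr⟩ := exists_between hr
  set A := ∑ j, α j
  have hA0 : 0 ≤ A := Finset.sum_nonneg fun j _ => hα j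
  obtain ⟨δ, hδ, hδs⟩ : ∃ δ > 0,
      cost α (fun j => (I (y j)).toReal) + 2 * F (y 0) + (3 + 2 * A + K) * δ = s :=
    ⟨(s - (cost α (fun j => (I (y j)).toReal) + 2 * F (y 0))) / (3 + 2 * A + K),
      by have := sub_pos.2 hs; positivity, by field_simp; ring⟩
  obtain ⟨N, hNc, hN, hbox⟩ := exists_isControlledBox hI hF hFε hρ hδ hy
  filter_upwards [hbox, eventually_le_sampleLaw_pi hd hLDP hα hα0 hδ hy hN hbox,
    eventually_natCast_mul_expDecay_le (Fintype.card (Equiv.Perm (Fin K))) hsr,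
    self_mem_nhdsWithin] with ε hbox hprob hcard hε
  have hlocal := expDecay_le_mul_weightedLaw (ENNReal.natCast_ne_top _)
    (MeasurableSet.univ_pi fun j => (hNc j).measurableSet)
    ((hd ε hε).ae_densWeight_ne_zero.mono fun z hz hzN =>
      hbox.ofReal_rhoTilde_mul_ge hε hα hzN hz) hprob
  refine (ENNReal.mul_le_mul_iff_right
    (Nat.cast_ne_zero.2 (Fintype.card_ne_zero (α := Equiv.Perm (Fin K))))
    (ENNReal.natCast_ne_top _)).1 ?_
  calc Fintype.card (Equiv.Perm (Fin K)) * expDecay r ε ≤ expDecay s ε := hcard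
    _ ≤ _ := expDecay_anti hε (le_of_eq ?_)
    _ ≤ Fintype.card (Equiv.Perm (Fin K)) * weightedLaw μ g Fε α ε (Set.univ.pi N) := hlocal
    _ ≤ Fintype.card (Equiv.Perm (Fin K)) * weightedMoment μ g Fε α ε := by
        rw [← weightedLaw_univ]
        gcongr
        exact Set.subset_univ _
  rw [← hδs, cost, Finset.sum_add_distrib, Finset.sum_const, Finset.card_univ, Fintype.card_fin,
    nsmul_eq_mul]
  ring

theorem eventually_le_weightedMoment (hd : ∀ ε, 0 < ε → HasDensities γ μ g α ε)
    (hLDP : SatisfiesLDP (fun ε => μ (ENNReal.ofReal ε)) I) (hI : ContinuousOn I {x | I x ≠ ∞})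
    (hF : Continuous F) (hFε : ∀ C : Set S, IsCompact C → TendstoUniformlyOn Fε F (𝓝[>] 0) C)
    (hρ : LogRatioTendstoZero I g α) (hα : ∀ j, 0 ≤ α j) (hα0 : 0 < α 0) {x₀ : S}
    (hx₀ : I x₀ = 0) {r : ℝ} (hr : V I F α < r) :
    ∀ᶠ ε in 𝓝[>] (0 : ℝ), expDecay r ε ≤ weightedMoment μ g Fε α ε := by
  classical
  obtain ⟨x, B, hx, hB, hcost⟩ := exists_cost_indicator_lt_of_V_lt hα hr
  refine eventually_le_weightedMoment_of_cost_lt hd hLDP hI hF hFε hρ hα hα0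
    (y := fun j => if j ∈ B then x else x₀) (fun j => ?_) ?_
  · split_ifs <;> simp [hx, hx₀]
  · simpa [apply_ite I, apply_ite ENNReal.toReal, hx₀, hB] using hcost

end Lower

end INS

end

theorem theorem3_general {𝓧 : Type*} [TopologicalSpace 𝓧] [T3Space 𝓧] [FirstCountableTopology 𝓧]
    [MeasurableSpace 𝓧] [OpensMeasurableSpace 𝓧] (K : ℕ) [NeZero K] (α : Fin K → ℝ)
    (hα_zero : 0 < α 0) (hα_nonneg : ∀ j, 0 ≤ α j)
    (γ : Measure 𝓧) [SigmaFinite γ] (μ : ℝ≥0∞ → Measure 𝓧) (g : ℝ≥0∞ → 𝓧 → ℝ≥0)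
    (hμ : ∀ ε : ℝ, 0 < ε → ∀ j, IsProbabilityMeasure (μ (INS.temp ε (α j))))
    (hg : ∀ ε : ℝ, 0 < ε → ∀ j, Measurable (g (INS.temp ε (α j))))
    (hμg : ∀ ε : ℝ, 0 < ε → ∀ j, μ (INS.temp ε (α j)) =
      γ.withDensity fun x => (g (INS.temp ε (α j)) x : ℝ≥0∞))
    (I : 𝓧 → ℝ≥0∞) (hLDP : INS.SatisfiesLDP (fun ε => μ (ENNReal.ofReal ε)) I)
    (hI : ContinuousOn I {x | I x ≠ ∞}) (F : 𝓧 → ℝ) (hF : Continuous F)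
    (Fε : ℝ → 𝓧 → ℝ) (hFε_meas : ∀ ε : ℝ, 0 < ε → Measurable (Fε ε))
    (hρ : INS.LogRatioTendstoZero I g α)
    (hFε : ∀ C : Set 𝓧, IsCompact C → TendstoUniformlyOn Fε F (𝓝[>] 0) C)
    (hFε_bdd : ∃ b : ℝ, ∀ ε ∈ Set.Ioo (0 : ℝ) 1, ∀ x, b ≤ Fε ε x) :
    Tendsto (fun ε : ℝ => -(ε : EReal) * ENNReal.log (INS.secondMoment μ g Fε α ε))
      (𝓝[>] 0) (𝓝 (INS.V I F α)) := by
  have hd : ∀ ε, 0 < ε → INS.HasDensities γ μ g α ε := fun ε hε => ⟨hμ ε hε, hg ε hε, hμg ε hε⟩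
  obtain ⟨x₀, hx₀⟩ := hLDP.exists_eq_zero fun ε hε => by
    simpa [INS.temp_of_pos _ hα_zero, hα_zero.ne'] using hμ (ε * α 0) (mul_pos hε hα_zero) 0
  obtain ⟨b, hb⟩ := hFε_bdd
  have hb : ∀ᶠ ε in 𝓝[>] (0 : ℝ), ∀ x, b ≤ Fε ε x := by
    filter_upwards [Ioo_mem_nhdsGT one_pos] using hb
  refine INS.tendsto_neg_mul_log (fun r hr => ?_) fun r hr => ?_
  · obtain ⟨s, hrs, hs⟩ := EReal.lt_iff_exists_real_btwn.1 hr
    filter_upwards [INS.eventually_weightedMoment_le hd hLDP hI hF hFε hρ hα_nonneg hα_zero hx₀ hb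
      hs, INS.eventually_natCast_mul_expDecay_le (Fintype.card (Equiv.Perm (Fin K)))
        (EReal.coe_lt_coe_iff.1 hrs), self_mem_nhdsWithin] with ε hle hcard hε
    calc INS.secondMoment μ g Fε α ε
        ≤ Fintype.card (Equiv.Perm (Fin K)) * INS.weightedMoment μ g Fε α ε :=
          INS.secondMoment_le_card_mul_weightedMoment (hd ε hε) (hFε_meas ε hε)
      _ ≤ Fintype.card (Equiv.Perm (Fin K)) * INS.expDecay s ε := by gcongr
      _ ≤ INS.expDecay r ε := hcard
  · filter_upwards [INS.eventually_le_weightedMoment hd hLDP hI hF hFε hρ hα_nonneg hα_zero hx₀ hr,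
      self_mem_nhdsWithin] with ε hle hε
    exact hle.trans (INS.weightedMoment_le_secondMoment (hd ε hε) (hFε_meas ε hε))

theorem theorem3 {𝓧 : Type*} [TopologicalSpace 𝓧] [PolishSpace 𝓧]
    [MeasurableSpace 𝓧] [BorelSpace 𝓧]
    -- the number of temperatures and the parameters `1 = α₁ ≥ ⋯ ≥ α_K ≥ 0`
    (K : ℕ) [NeZero K] (α : Fin K → ℝ) (hα_one : α 0 = 1) (hα_anti : Antitone α)
    (hα_nonneg : ∀ j, 0 ≤ α j)
    -- probability measures `μ^t` with densities `g^t`, for the temperatures `t = ε / α_j`, `ε > 0`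
    -- (every `t ∈ (0, ∞)`, because `α₁ = 1`; also `t = ∞` if some `α_j` is `0`)
    (γ : MeasureTheory.Measure 𝓧) [MeasureTheory.SigmaFinite γ]
    (μ : ℝ≥0∞ → MeasureTheory.Measure 𝓧) (g : ℝ≥0∞ → 𝓧 → ℝ≥0)
    (hμ : ∀ ε : ℝ, 0 < ε → ∀ j, MeasureTheory.IsProbabilityMeasure (μ (INS.temp ε (α j))))
    (hg : ∀ ε : ℝ, 0 < ε → ∀ j, Measurable (g (INS.temp ε (α j))))
    (hμg : ∀ ε : ℝ, 0 < ε → ∀ j, μ (INS.temp ε (α j)) =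
      γ.withDensity fun x => (g (INS.temp ε (α j)) x : ℝ≥0∞))
    -- the large deviation principle
    (I : 𝓧 → ℝ≥0∞) (hLDP : INS.SatisfiesLDP (fun ε => μ (ENNReal.ofReal ε)) I)
    (hI : ContinuousOn I {x | I x ≠ ∞})
    (F : 𝓧 → ℝ) (hF : Continuous F) (hF_bdd : BddBelow (Set.range F))
    (Fε : ℝ → 𝓧 → ℝ) (hFε_meas : ∀ ε : ℝ, 0 < ε → Measurable (Fε ε))
    (hρ : INS.LogRatioTendstoZero I g α)
    (hFε : ∀ C : Set 𝓧, IsCompact C → TendstoUniformlyOn Fε F (𝓝[>] 0) C)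
    (hFε_bdd : ∃ b : ℝ, ∀ ε ∈ Set.Ioo (0 : ℝ) 1, ∀ x, b ≤ Fε ε x) :
    Tendsto (fun ε : ℝ => -(ε : EReal) * ENNReal.log (INS.secondMoment μ g Fε α ε))
      (𝓝[>] 0) (𝓝 (INS.V I F α)) :=
  theorem3_general K α (hα_one ▸ one_pos) hα_nonneg γ μ g hμ hg hμg I hLDP hI F hF Fε hFε_meas hρ
    hFε hFε_bdd
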